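/- **Setting.** Let $\mathcal X=\mathbb R^{d_1}$, let $\mathcal H$ be a non-empty set of measurable feature extractors $h:\mathbb R^{d_1}\to\mathbb R^{d_2}$, $\mathcal F$ a non-empty set of measurable pre-training classifiers $f:\mathbb R^{d_2}\to\mathbb R^K$ and $\tilde{\mathcal F}$ a non-empty set of downstream classifiers $f:\mathbb R^{d_2}\to\mathbb R^{\tilde K}$. Assume that $\mathcal F\circ\mathcal H$ is pointwise separable: there is a countable subset of $\mathcal F\times\mathcal H$ such that every $f\circ h$ is a pointwise limit of a sequence of compositions from it. Let $\ell(u,y)=-\log\big(e^{u_y}/\sum_i e^{u_i}\big)$ be the cross-entropy loss. *Data.* Let $\mathcal D$ be a probability measure on the space $\Delta(\mathcal X)$ of probability measures on $\mathcal X$, and let $K,n\ge 1$, $N=nK$. First $\mathcal P=(\mathcal P_1,\dots,\mathcal P_K)$ is drawn i.i.d. from $\mathcal D$; then, given $\mathcal P$, the samples $x_{i,j}\sim\mathcal P_i$ ($i\le K$, $j\le n$) are drawn independently, $x_{i,j}$ with label $i$. The resulting data set is $S$. The downstream data set consists of $\tilde N$ i.i.d. examples $(\tilde x_t,\tilde y_t)$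 from a probability measure $\tilde{\mathcal P}$ on $\mathcal X\times[\tilde K]$ for which all $\ell(f\circ h(\tilde x),\tilde y)$, $f\in\tilde{\mathcal F}$, $h\in\mathcal H$, are integrable. *Risks.* Put $$\mathcal R_p(h,\mathcal P)=\inf_{f\in\mathcal F}\mathbb E_{S\mid\mathcal P}\frac1{N}\sum_{i,j}\ell(f\circ h(x_{i,j}),i),\qquad \mathcal E_p(h,\mathcal P)=\mathcal R_p(h,\mathcal P)-\inf_{h'\in\mathcal H}\mathcal R_p(h',\mathcal P),$$ $$\mathcal R_d(h)=\inf_{f\in\tilde{\mathcal F}}\mathbb E\sum_{t=1}^{\tilde N}\ell(f\circ h(\tilde x_t),\tilde y_t),\qquad \mathcal E_d(h)=\mathcal R_d(h)-\inf_{h'\in\mathcal H}\mathcal R_d(h').$$ An ERM feature extractor is any $\hat h_S\in\arg\min_{h\in\mathcal H}\inf_{f\in\mathcal F}\sum_{i,j}\ell(f\circ h(x_{i,j}),i)$. **Assumptions.** 1. There is $M_\ell>0$ with $\ell(f\circ h(x),i)\le M_\ell$ for all $i\in[K]$, $f\in\mathcal F$, $h\in\mathcal H$, $x\in\mathcal X$.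 Each $\ell(\cdot,i)$, $i\in[K]$, is $L_\ell$-Lipschitz on $\mathbb R^K$ for the Euclidean norm. There is a constant $G$ such that for every probability measure $Q$ on $\mathcal X$ and every $m\ge1$ $$\mathbb E_{x\sim Q^m}\,\mathbb E_{\sigma\sim\mathcal N(0,I_{m\times K})}\sup_{f\in\mathcal F,h\in\mathcal H}\sum_{i=1}^m\sum_{j=1}^K\sigma_{i,j}f_j(h(x_i))\le G\sqrt m .$$ 2. There are measurable functions $\nu_0,\nu_1\ge0$ of $\mathcal P\in\Delta(\mathcal X)^K$ with $\mathcal E_d(h)\le\nu_1(\mathcal P)\,\mathcal E_p(h,\mathcal P)+\nu_0(\mathcal P)$ for all $\mathcal P$ and all $h\in\mathcal H$. There are constants $M_0,M_1>0$ with $|\nu_a(\mathcal P)-\nu_a(\mathcal P')|\le M_a/K$ ($a=0,1$) whenever $\mathcal P,\mathcal P'$ differ in one component only. There are real numbers $\nu_a(\mathcal D)$, $C_a$ with $|\mathbb E_{\mathcal P\sim\mathcal D^K}\nu_a(\mathcal P)-\nu_a(\mathcal D)|\le C_a/\sqrt K$ ($a=0,1$). **Conclusion.** Let $\delta\in(0,1)$.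 With probability at least $1-\delta$ over $\mathcal P$ and $S$, every ERM feature extractor $\hat h_S$ satisfies $\mathcal E_d(\hat h_S)\le U(n,K)$, where $$U(n,K)=\left(\nu_1(\mathcal D)+M_1\sqrt{\tfrac{\log(4/\delta)}{2K}}+\tfrac{C_1}{\sqrt K}\right)\left(5M_\ell\sqrt{\tfrac{\log(4/\delta)}{2n}}+\tfrac{2GL_\ell}{\sqrt n}\right)+\nu_0(\mathcal D)+M_0\sqrt{\tfrac{\log(4/\delta)}{2K}}+\tfrac{C_0}{\sqrt K}.$$ Moreover, for all real $n,K>0$ and with $N=nK$, $$U(n,K)=\frac A{\sqrt n}+\frac B{\sqrt K}+\frac C{\sqrt N}+\nu_0(\mathcal D),$$ where, with $\lambda=\sqrt{\log(4/\delta)/2}$, $A=\nu_1(\mathcal D)(5M_\ell\lambda+2GL_\ell)$, $B=M_0\lambda+C_0$ and $C=(M_1\lambda+C_1)(5M_\ell\lambda+2GL_\ell)$. If $A>0$, then for every fixed $N>0$ the function $U$ on $\{(n,K)\in(0,\infty)^2: nK=N\}$ has its minimum exactly where the class-to-sample ratio is $K/n=B^2/A^2$. -/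

import Mathlib

open MeasureTheory ProbabilityTheory Filter Topology
open scoped ENNReal NNReal

/-- Cross-entropy loss `ℓ(u, y) = - log (exp u_y / ∑ i, exp u_i)` of a score vector `u ∈ ℝ^K`
at the label `y ∈ [K]`. -/
noncomputable def crossEntropy {K : ℕ} (u : EuclideanSpace ℝ (Fin K)) (y : Fin K) : ℝ :=
  -Real.log (Real.exp (u y) / ∑ i, Real.exp (u i))

/-- The law of `m` i.i.d. samples from `Q`. -/
noncomputable def iidLaw {X : Type*} [MeasurableSpace X] (Q : ProbabilityMeasure X) (m : ℕ) :
    Measure (Fin m → X) :=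
  Measure.pi fun _ => (Q : Measure X)

/-- The law of a pre-training data set, given the class distributions `P i`: the samples `x i j`
(`j`-th sample of class `i`, carrying the label `i`) are independent, `x i j` with law `P i`. -/
noncomputable def datasetLaw {X : Type*} [MeasurableSpace X] {K : ℕ}
    (P : Fin K → ProbabilityMeasure X) (n : ℕ) : Measure (Fin K → Fin n → X) :=
  Measure.pi fun i => iidLaw (P i) n

instance iidLaw_isProbabilityMeasure {X : Type*} [MeasurableSpace X] (Q : ProbabilityMeasure X)
    (m : ℕ) : IsProbabilityMeasure (iidLaw Q m) := by
  unfold iidLaw; infer_instance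

instance datasetLaw_isProbabilityMeasure {X : Type*} [MeasurableSpace X] {K : ℕ}
    (P : Fin K → ProbabilityMeasure X) (n : ℕ) : IsProbabilityMeasure (datasetLaw P n) := by
  unfold datasetLaw; infer_instance

/-- A product of probability measures that depend measurably on a parameter depends measurably
on the parameter. -/
theorem measurable_measure_pi {α X ι : Type*} [MeasurableSpace α] [MeasurableSpace X] [Fintype ι]
    (μ : α → ι → Measure X) [∀ a i, IsProbabilityMeasure (μ a i)]
    (hμ : ∀ i, Measurable fun a => μ a i) : Measurable fun a => Measure.pi (μ a) := by
  refine Measurable.measure_of_isPiSystem_of_isProbabilityMeasure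
    (generateFrom_pi (ι := ι) (α := fun _ => X)).symm isPiSystem_pi ?_
  rintro _ ⟨s, hs, rfl⟩
  simp only [Measure.pi_pi]
  exact Finset.measurable_prod _ fun i _ =>
    (Measure.measurable_coe (hs i (Set.mem_univ i))).comp (hμ i)

theorem measurable_datasetLaw {X : Type*} [MeasurableSpace X] {K : ℕ} (n : ℕ) :
    Measurable fun P : Fin K → ProbabilityMeasure X => datasetLaw P n := by
  refine measurable_measure_pi
    (fun (P : Fin K → ProbabilityMeasure X) i => iidLaw (P i) n) fun i => ?_
  refine measurable_measure_pi (fun (P : Fin K → ProbabilityMeasure X) _ => (P i : Measure X))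
    fun _ => ?_
  exact measurable_subtype_coe.comp (measurable_pi_apply i)

/-- The second sampling stage, as a Markov kernel from the class distributions to data sets. -/
noncomputable def datasetKernel {X : Type*} [MeasurableSpace X] (K n : ℕ) :
    Kernel (Fin K → ProbabilityMeasure X) (Fin K → Fin n → X) :=
  ⟨fun P => datasetLaw P n, measurable_datasetLaw n⟩

/-- The law of `K` i.i.d. class distributions drawn from the meta-distribution `D`. -/
noncomputable def classLaw {X : Type*} [MeasurableSpace X] (D : Measure (ProbabilityMeasure X))
    (K : ℕ) : Measure (Fin K → ProbabilityMeasure X) :=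
  Measure.pi fun _ => D

/-- The joint law of the two-stage sampling process: first `K` class distributions i.i.d. from
`D`, then, given these, `n` i.i.d. samples from each class distribution. -/
noncomputable def pretrainLaw {X : Type*} [MeasurableSpace X] (D : Measure (ProbabilityMeasure X))
    (K n : ℕ) : Measure ((Fin K → ProbabilityMeasure X) × (Fin K → Fin n → X)) :=
  classLaw D K ⊗ₘ datasetKernel K n

/-- Expectation of an extended-real random variable, `E[S⁺] - E[S⁻]`. -/
noncomputable def extExpectation {Ω : Type*} [MeasurableSpace Ω] (μ : Measure Ω)
    (S : Ω → EReal) : EReal :=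
  ((∫⁻ ω, (S ω).toENNReal ∂μ : ℝ≥0∞) : EReal) - ((∫⁻ ω, (-S ω).toENNReal ∂μ : ℝ≥0∞) : EReal)

/-- The Gaussian complexity of `𝓕 ∘ 𝓗` over `Q` with `m` samples:
`E_{x ∼ Q^m} E_{σ ∼ N(0, I)} sup_{f, h} ∑ i, ∑ j, σ i j * f_j (h (x i))`, a value in `[-∞, ∞]`. -/
noncomputable def gaussianComplexity {X Z : Type*} [MeasurableSpace X] {K : ℕ}
    (𝓕 : Set (Z → EuclideanSpace ℝ (Fin K))) (𝓗 : Set (X → Z)) (Q : ProbabilityMeasure X)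
    (m : ℕ) : EReal :=
  extExpectation (iidLaw Q m) fun x =>
    extExpectation (Measure.pi fun _ : Fin m => Measure.pi fun _ : Fin K => gaussianReal 0 1)
      fun σ => ⨆ f ∈ 𝓕, ⨆ h ∈ 𝓗, ((∑ i, ∑ j, σ i j * f (h (x i)) j : ℝ) : EReal)

/-- `h` is an empirical risk minimizing feature extractor on the data set `x`:
`h ∈ argmin_{h ∈ 𝓗} min_{f ∈ 𝓕} ∑ i, ∑ j, ℓ(f (h (x i j)), i)`. -/
def IsERM {X Z : Type*} {K n : ℕ} (𝓕 : Set (Z → EuclideanSpace ℝ (Fin K))) (𝓗 : Set (X → Z))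
    (x : Fin K → Fin n → X) (h : X → Z) : Prop :=
  h ∈ 𝓗 ∧ IsMinOn
    (fun h' : X → Z => ⨅ f : 𝓕, ∑ i, ∑ j, crossEntropy ((f : Z → _) (h' (x i j))) i) 𝓗 h

/-- Pre-training risk of the feature extractor `h`, for class distributions `P` and `n` samples
per class: `min_f E_S (1 / N) ∑ ℓ(f (h (x i j)), i)` with `N = n K`. -/
noncomputable def pretrainRisk {X Z : Type*} [MeasurableSpace X] {K : ℕ}
    (𝓕 : Set (Z → EuclideanSpace ℝ (Fin K))) (n : ℕ) (h : X → Z)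
    (P : Fin K → ProbabilityMeasure X) : ℝ :=
  ⨅ f : 𝓕, ∫ x, 1 / ((n : ℝ) * (K : ℝ)) *
    ∑ i, ∑ j, crossEntropy ((f : Z → _) (h (x i j))) i ∂(datasetLaw P n)

/-- Pre-training representation error. -/
noncomputable def pretrainError {X Z : Type*} [MeasurableSpace X] {K : ℕ}
    (𝓕 : Set (Z → EuclideanSpace ℝ (Fin K))) (𝓗 : Set (X → Z)) (n : ℕ) (h : X → Z)
    (P : Fin K → ProbabilityMeasure X) : ℝ :=
  pretrainRisk 𝓕 n h P - ⨅ h' : 𝓗, pretrainRisk 𝓕 n (h' : X → Z) P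

/-- Downstream risk of the feature extractor `h`, for `N'` i.i.d. examples from `P'`. -/
noncomputable def downstreamRisk {X Z : Type*} [MeasurableSpace X] {K' : ℕ}
    (𝓕' : Set (Z → EuclideanSpace ℝ (Fin K'))) (P' : Measure (X × Fin K')) (N' : ℕ)
    (h : X → Z) : ℝ :=
  ⨅ f : 𝓕', ∫ S, ∑ t, crossEntropy ((f : Z → _) (h (S t).1)) (S t).2
    ∂(Measure.pi fun _ : Fin N' => P')

/-- Downstream representation error. -/
noncomputable def downstreamError {X Z : Type*} [MeasurableSpace X] {K' : ℕ}
    (𝓕' : Set (Z → EuclideanSpace ℝ (Fin K'))) (𝓗 : Set (X → Z)) (P' : Measure (X × Fin K'))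
    (N' : ℕ) (h : X → Z) : ℝ :=
  downstreamRisk 𝓕' P' N' h - ⨅ h' : 𝓗, downstreamRisk 𝓕' P' N' (h' : X → Z)

/-- The class of compositions `f ∘ h` is pointwise separable: a countable set of pairs gives, as
pointwise limits of sequences, all compositions. This makes suprema and infima over the class
measurable. -/
def PointwiseSeparable {X Z : Type*} {K : ℕ} (𝓕 : Set (Z → EuclideanSpace ℝ (Fin K)))
    (𝓗 : Set (X → Z)) : Prop :=
  ∃ T : Set ((Z → EuclideanSpace ℝ (Fin K)) × (X → Z)), T.Countable ∧ T ⊆ 𝓕 ×ˢ 𝓗 ∧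
    ∀ f ∈ 𝓕, ∀ h ∈ 𝓗, ∃ u : ℕ → (Z → EuclideanSpace ℝ (Fin K)) × (X → Z), (∀ k, u k ∈ T) ∧
      ∀ x, Tendsto (fun k => (u k).1 ((u k).2 x)) atTop (𝓝 (f (h x)))

/-- The constants of the bound: the limits `ν₀(D)`, `ν₁(D)`, the stability constants `M₀`, `M₁`,
the concentration constants `C₀`, `C₁`, the bound `Mloss` and a Lipschitz constant `Lloss` of the
loss, the complexity constant `G`, and the failure probability `δ`. -/
structure BoundConstants where
  ν₀D : ℝ
  ν₁D : ℝ
  M₀ : ℝ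
  M₁ : ℝ
  C₀ : ℝ
  C₁ : ℝ
  Mloss : ℝ
  Lloss : ℝ
  G : ℝ
  δ : ℝ

namespace BoundConstants

/-- The bound, as a function of the number `n` of samples per class and the number `K` of
classes. -/
noncomputable def bound (c : BoundConstants) (n K : ℝ) : ℝ :=
  (c.ν₁D + c.M₁ * √(Real.log (4 / c.δ) / (2 * K)) + c.C₁ / √K) *
      (5 * c.Mloss * √(Real.log (4 / c.δ) / (2 * n)) + 2 * c.G * c.Lloss / √n) +
    c.ν₀D + c.M₀ * √(Real.log (4 / c.δ) / (2 * K)) + c.C₀ / √K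

/-- Coefficient of `1 / √n`. -/
noncomputable def coeffA (c : BoundConstants) : ℝ :=
  c.ν₁D * (5 * c.Mloss * √(Real.log (4 / c.δ) / 2) + 2 * c.G * c.Lloss)

/-- Coefficient of `1 / √K`. -/
noncomputable def coeffB (c : BoundConstants) : ℝ :=
  c.M₀ * √(Real.log (4 / c.δ) / 2) + c.C₀

/-- Coefficient of `1 / √N`. -/
noncomputable def coeffC (c : BoundConstants) : ℝ :=
  (c.M₁ * √(Real.log (4 / c.δ) / 2) + c.C₁) *
    (5 * c.Mloss * √(Real.log (4 / c.δ) / 2) + 2 * c.G * c.Lloss)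

end BoundConstants

/-! By the transfer assumption it is enough that `ν₀ P ≤ v₀`, `ν₁ P ≤ v₁` and that the pre-training
error of an ERM is at most `t`, where `v₁ * t + v₀` is the claimed bound. Each of these three events
fails with probability at most `δ / 4`. The first two are McDiarmid's inequality
(`hasSubgaussianMGF_of_abs_sub_update_le`) for functions of the class distributions with differences
`M / K`.

For the third, fix the class distributions. The excess risk of an approximate ERM is controlled by
the uniform deviation of expected from empirical loss, measured relative to one near-optimal
reference function. McDiarmid bounds the fluctuation of this supremum, symmetrization
(`integral_ciSup_deviation_le`) bounds its mean by Rademacher averages of the loss, and a vector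
contraction (`rademacher_le_gaussian`) bounds these by Gaussian averages of the scores, at the price
`L * √(π / 2)`.

The difficulty is that the samples of different classes have different laws, and that symmetrization
leaves a fixed set of `N` points, while the complexity assumption speaks of i.i.d. samples from one
law. As it holds for all laws and all `m`, it can be applied to `m` draws from the empirical law of
the fixed points. As `m` grows each point is drawn about `m / N` times, the Gaussians attached to
its copies add up to a Gaussian of size about `√(m / N)`, and the bound `G * √m` becomes `G * √N`
for the fixed points (`gaussian_average_le`).

After division by `n * K` the claimed term `2 * G * L / √n` has a spare factor `√K`. It absorbs `√(π
/ 2)` when `K ≥ 2`; for `K = 1` the loss vanishes.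

All suprema are taken over finite subfamilies of a dense sequence of compositions. Monotone limits
give the countable family, and `pretrainError_le_of_isERM` passes to arbitrary ERMs by
approximation. The optimal ratio is the equality case of the inequality between arithmetic and
geometric means for `A / √n` and `B / √K`, whose product depends only on `n * K`. -/

/-! ### Gaussian vectors and matrices -/

/-- The standard Gaussian law on `ℝ^K`. -/
noncomputable abbrev gaussianVec (K : ℕ) : Measure (Fin K → ℝ) :=
  Measure.pi fun _ => gaussianReal 0 1

/-- The standard Gaussian law on `ℝ^(m × K)`. -/
noncomputable abbrev gaussianMat (m K : ℕ) : Measure (Fin m → Fin K → ℝ) :=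
  Measure.pi fun _ => gaussianVec K

/-- A sum of independent centered Gaussians is Gaussian. -/
theorem map_sum_pi_gaussian {ι : Type*} [Fintype ι] {E : ι → Type*} [∀ i, MeasurableSpace (E i)]
    (μ : ∀ i, Measure (E i)) [∀ i, IsProbabilityMeasure (μ i)] (l : ∀ i, E i → ℝ)
    (hl : ∀ i, Measurable (l i)) (v : ι → ℝ≥0)
    (h : ∀ i, (μ i).map (l i) = gaussianReal 0 (v i)) :
    (Measure.pi μ).map (fun x => ∑ i, l i (x i)) = gaussianReal 0 (∑ i, v i) := by
  have h1 : (Measure.pi μ).map (fun x i => l i (x i)) = Measure.pi fun i => gaussianReal 0 (v i) := by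
    have : ∀ i, SigmaFinite ((μ i).map (l i)) := fun i => by rw [h i]; infer_instance
    rw [Measure.pi_map_pi fun i => (hl i).aemeasurable]
    simp_rw [h]
  have h2 : (fun x : ∀ i, E i => ∑ i, l i (x i)) = (fun p : ι → ℝ => ∑ i, p i) ∘
    fun x i => l i (x i) := rfl
  rw [h2, ← Measure.map_map (by fun_prop) (by fun_prop), h1]
  apply Measure.ext_of_charFun
  rw [charFun_map_sum_pi_eq_prod]
  ext t
  simp only [Finset.prod_apply, charFun_gaussianReal, ← Complex.exp_sum]
  congr 1
  push_cast
  simp [Finset.sum_mul, Finset.sum_div]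

theorem map_gaussianVec {K : ℕ} (b : Fin K → ℝ) :
    (gaussianVec K).map (fun g => ∑ j, g j * b j) =
      gaussianReal 0 (∑ j, ‖b j‖₊ ^ 2) := by
  refine map_sum_pi_gaussian (fun _ : Fin K => gaussianReal 0 1) (fun j x => x * b j)
    (fun j => by fun_prop) _ fun j => ?_
  rw [gaussianReal_map_mul_const, mul_zero, mul_one]
  congr 1
  apply NNReal.eq
  simp

theorem map_gaussianMat {m K : ℕ} (b : Fin m → Fin K → ℝ) :
    (gaussianMat m K).map (fun σ => ∑ s, ∑ j, σ s j * b s j) =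
      gaussianReal 0 (∑ s, ∑ j, ‖b s j‖₊ ^ 2) :=
  map_sum_pi_gaussian (fun _ : Fin m => gaussianVec K) (fun s x => ∑ j, x j * b s j)
    (fun s => by fun_prop) _ fun s => map_gaussianVec (b s)

/-- Folding onto the half-line leaves a Gamma integral equal to `1`. The inverse of this constant is
the price of the contraction step. -/
theorem integral_abs_gaussianReal : ∫ x, |x| ∂(gaussianReal 0 1) = √(2 / Real.pi) := by
  have h1 : ∫ x, |x| ∂(gaussianReal 0 1) =
      (√(2 * Real.pi))⁻¹ * ∫ x : ℝ, |x| * Real.exp (-(1 / 2) * |x| ^ 2) := by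
    rw [integral_gaussianReal_eq_integral_smul (by norm_num), ← integral_const_mul]
    congr 1
    ext x
    simp [gaussianPDFReal]
    ring_nf
  rw [h1, integral_comp_abs (f := fun x => x * Real.exp (-(1 / 2) * x ^ 2))]
  have h2 := integral_rpow_mul_exp_neg_mul_rpow (p := 2) (q := 1) (b := 1 / 2)
    (by norm_num) (by norm_num) (by norm_num)
  have h3 : ∫ x in Set.Ioi (0 : ℝ), x * Real.exp (-(1 / 2) * x ^ 2) = 1 := by
    have h4 : (1 / 2 : ℝ) ^ (-(1 + 1) / 2 : ℝ) * (1 / 2) * Real.Gamma ((1 + 1) / 2) = 1 := by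
      norm_num [Real.rpow_neg_one]
    refine Eq.trans (setIntegral_congr_fun measurableSet_Ioi fun x _ => ?_) (h2.trans h4)
    norm_num
  rw [h3]
  have hpi := Real.pi_pos
  rw [Real.sqrt_div (by norm_num), Real.sqrt_mul (by norm_num)]
  have h4 : √2 * √2 = 2 := Real.mul_self_sqrt (by norm_num)
  field_simp
  linarith

theorem integral_abs_gaussianReal_sq (a : ℝ) (ha : 0 ≤ a) :
    ∫ x, |x| ∂(gaussianReal 0 (‖a‖₊ ^ 2)) = √(2 / Real.pi) * a := by
  have : (gaussianReal 0 1).map (fun x => a * x) = gaussianReal 0 (‖a‖₊ ^ 2) := by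
    rw [gaussianReal_map_const_mul, mul_zero, mul_one]
    congr 1
    apply NNReal.eq
    simp
  rw [← this, integral_map (by fun_prop) (by fun_prop)]
  simp_rw [abs_mul, abs_of_nonneg ha]
  rw [integral_const_mul, integral_abs_gaussianReal, mul_comm]

/-- A linear form in a standard Gaussian vector is Gaussian with variance `‖w‖ ^ 2`. The Euclidean
norm thus becomes an average of absolute values of linear forms, which linearizes a Lipschitz bound.
-/
theorem integral_abs_gaussianVec {K : ℕ} (w : EuclideanSpace ℝ (Fin K)) :
    ∫ g, |∑ j, g j * w j| ∂(gaussianVec K) = √(2 / Real.pi) * ‖w‖ := by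
  have hm : Measurable fun g : Fin K → ℝ => ∑ j, g j * w j := by fun_prop
  rw [← integral_abs_gaussianReal_sq _ (norm_nonneg w)]
  have h := map_gaussianVec (fun j => w j)
  have h2 : (∑ j, ‖w j‖₊ ^ 2 : ℝ≥0) = ‖‖w‖‖₊ ^ 2 := by
    apply NNReal.eq
    simp [EuclideanSpace.norm_sq_eq]
  rw [← h2, ← h, integral_map hm.aemeasurable (by fun_prop)]

theorem integrable_gaussianMat_apply {m K : ℕ} (b : Fin m → Fin K → ℝ) :
    Integrable (fun σ => ∑ s, ∑ j, σ s j * b s j) (gaussianMat m K) := by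
  have h := (memLp_id_gaussianReal (μ := 0)
    (v := ∑ s, ∑ j, ‖b s j‖₊ ^ 2) 1).integrable le_rfl
  have hm : Measurable fun g : Fin m → Fin K → ℝ => ∑ s, ∑ j, g s j * b s j := by fun_prop
  rw [← map_gaussianMat b] at h
  exact h.comp_measurable hm

theorem integral_gaussianMat_apply {m K : ℕ} (b : Fin m → Fin K → ℝ) :
    ∫ σ, ∑ s, ∑ j, σ s j * b s j ∂(gaussianMat m K) = 0 := by
  have h := integral_id_gaussianReal (μ := 0) (v := ∑ s, ∑ j, ‖b s j‖₊ ^ 2)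
  have hm : Measurable fun g : Fin m → Fin K → ℝ => ∑ s, ∑ j, g s j * b s j := by fun_prop
  rw [← map_gaussianMat b, integral_map hm.aemeasurable (by fun_prop)] at h
  exact h

theorem integrable_gaussianVec_apply {K : ℕ} (b : Fin K → ℝ) :
    Integrable (fun g => ∑ j, g j * b j) (gaussianVec K) := by
  have h := (memLp_id_gaussianReal (μ := 0)
    (v := ∑ j, ‖b j‖₊ ^ 2) 1).integrable le_rfl
  have hm : Measurable fun g : Fin K → ℝ => ∑ j, g j * b j := by fun_prop
  rw [← map_gaussianVec b] at h
  exact h.comp_measurable hm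

theorem map_neg_gaussianVec (K : ℕ) : (gaussianVec K).map (fun g => -g) = gaussianVec K := by
  have h : ∀ _ : Fin K, (gaussianReal 0 1).map (fun x : ℝ => -x) = gaussianReal 0 1 := fun _ => by
    rw [gaussianReal_map_neg]; simp
  have : ∀ _ : Fin K, SigmaFinite ((gaussianReal 0 1).map (fun x : ℝ => -x)) := fun i => by
    rw [h i]; infer_instance
  have := Measure.pi_map_pi (μ := fun _ : Fin K => gaussianReal 0 1) (f := fun _ (x : ℝ) => -x)
    (fun _ => by fun_prop)
  simp_rw [gaussianReal_map_neg, neg_zero] at this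
  exact this

/-- The sums of a Gaussian matrix over the fibres of `τ` are distributed as a Gaussian matrix
whose rows are scaled by the square roots of the cardinalities of the fibres. -/
theorem map_fiberSum_gaussianMat {m N K : ℕ} (τ : Fin m → Fin N) :
    (gaussianMat m K).map (fun σ t j => ∑ s, if τ s = t then σ s j else 0) =
      (gaussianMat N K).map
        (fun g t j => √(((Finset.univ.filter fun s => τ s = t).card : ℝ)) * g t j) := by
  have hm1 : Measurable (fun (σ : Fin m → Fin K → ℝ) (t : Fin N) (j : Fin K) =>
      ∑ s, if τ s = t then σ s j else 0) := by
    refine measurable_pi_lambda _ fun t => measurable_pi_lambda _ fun j =>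
      Finset.measurable_sum _ fun s _ => ?_
    split_ifs <;> fun_prop
  have hm2 : Measurable (fun (g : Fin N → Fin K → ℝ) (t : Fin N) (j : Fin K) =>
      √(((Finset.univ.filter fun s => τ s = t).card : ℝ)) * g t j) := by fun_prop
  have := Measure.isProbabilityMeasure_map (μ := gaussianMat m K) hm1.aemeasurable
  have := Measure.isProbabilityMeasure_map (μ := gaussianMat N K) hm2.aemeasurable
  -- Both laws are centered Gaussian, so it suffices that every linear form `L` has the same
  -- variance under each.
  apply Measure.ext_of_charFunDual
  ext L
  set a : Fin N → Fin K → ℝ := fun t j => L (Pi.single t (Pi.single j 1)) with ha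
  have hL : ∀ x : Fin N → Fin K → ℝ, L x = ∑ t, ∑ j, x t j * a t j := by
    intro x
    have : x = ∑ t, ∑ j, x t j • (Pi.single t (Pi.single j 1) : Fin N → Fin K → ℝ) := by
      ext t j
      simp [Finset.sum_apply, Pi.single_apply, Finset.sum_ite_eq, ite_apply]
    conv_lhs => rw [this]
    simp [ha, map_sum]
  have key : ∀ (p : ℕ) (f : (Fin p → Fin K → ℝ) → Fin N → Fin K → ℝ) (hf : Measurable f)
      (b : Fin p → Fin K → ℝ) (hb : ∀ σ, L (f σ) = ∑ s, ∑ j, σ s j * b s j),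
      charFunDual ((gaussianMat p K).map f) L =
        ∫ x : ℝ, Complex.exp (x * Complex.I)
          ∂(gaussianReal 0 (∑ s, ∑ j, ‖b s j‖₊ ^ 2)) := by
    intro p f hf b hb
    have hm : Measurable fun g : Fin p → Fin K → ℝ => ∑ s, ∑ j, g s j * b s j := by fun_prop
    rw [charFunDual_apply, integral_map hf.aemeasurable (by fun_prop), ← map_gaussianMat b,
      integral_map hm.aemeasurable (by fun_prop)]
    simp_rw [hb]
  rw [key m _ hm1 (fun s j => a (τ s) j), key N _ hm2
    (fun t j => √(((Finset.univ.filter fun s => τ s = t).card : ℝ)) * a t j)]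
  · congr 2
    apply NNReal.eq
    simp only [NNReal.coe_sum, NNReal.coe_pow, coe_nnnorm, Real.norm_eq_abs, sq_abs, mul_pow,
      Real.sq_sqrt (Nat.cast_nonneg _)]
    rw [← Finset.sum_fiberwise_of_maps_to (t := Finset.univ) (g := τ) fun _ _ => Finset.mem_univ _]
    refine Finset.sum_congr rfl fun t _ => ?_
    rw [Finset.sum_congr rfl (g := fun _ => ∑ j, a t j ^ 2), Finset.sum_const, nsmul_eq_mul,
      Finset.mul_sum]
    intro s hs
    rw [(Finset.mem_filter.1 hs).2]
  · intro g
    rw [hL]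
    refine Finset.sum_congr rfl fun t _ => Finset.sum_congr rfl fun j _ => by ring
  · intro σ
    rw [hL]
    rw [← Finset.sum_fiberwise_of_maps_to (t := Finset.univ) (g := τ) fun _ _ => Finset.mem_univ _]
    refine Finset.sum_congr rfl fun t _ => ?_
    rw [Finset.sum_comm]
    refine Finset.sum_congr rfl fun j _ => ?_
    rw [Finset.sum_mul, Finset.sum_filter]
    refine Finset.sum_congr rfl fun s _ => ?_
    split_ifs with h <;> simp [h]

/-! ### Finite suprema and splitting off one coordinate -/

theorem le_ciSup_finite {ι : Type*} [Finite ι] (f : ι → ℝ) (k : ι) : f k ≤ ⨆ k, f k :=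
  le_ciSup (Set.finite_range f).bddAbove k

theorem integrable_ciSup_finite {Ω ι : Type*} [MeasurableSpace Ω] {μ : Measure Ω} [Finite ι]
    [Nonempty ι] {f : ι → Ω → ℝ} (hm : ∀ k, Measurable (f k)) (hf : ∀ k, Integrable (f k) μ) :
    Integrable (fun ω => ⨆ k, f k ω) μ := by
  cases nonempty_fintype ι
  refine Integrable.mono' (integrable_finsetSum Finset.univ fun k _ => (hf k).abs)
    (Measurable.iSup hm).aestronglyMeasurable (ae_of_all _ fun ω => ?_)
  obtain ⟨k, hk⟩ := exists_eq_ciSup_of_finite (f := fun k => f k ω)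
  rw [← hk, Real.norm_eq_abs]
  exact Finset.single_le_sum (f := fun k => |f k ω|) (fun _ _ => abs_nonneg _) (Finset.mem_univ k)

theorem measurePreserving_finCons {E : Type*} [MeasurableSpace E] {N : ℕ}
    (μ : Fin (N + 1) → Measure E) [∀ i, IsProbabilityMeasure (μ i)] :
    MeasurePreserving (fun p : E × (Fin N → E) => (Fin.cons p.1 p.2 : Fin (N + 1) → E))
      ((μ 0).prod (Measure.pi fun i => μ (Fin.succ i))) (Measure.pi μ) := by
  have h := (measurePreserving_piFinSuccAbove μ 0).symm
  simp only [Fin.zero_succAbove] at h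
  convert h using 1
  ext p
  simp [MeasurableEquiv.piFinSuccAbove, Fin.insertNthEquiv]

/-- Integration over a product indexed by `Fin (N + 1)`, with the first coordinate inside. -/
theorem integral_pi_succ {E : Type*} [MeasurableSpace E] {N : ℕ} (μ : Fin (N + 1) → Measure E)
    [∀ i, IsProbabilityMeasure (μ i)] {f : (Fin (N + 1) → E) → ℝ}
    (hf : Integrable f (Measure.pi μ)) :
    ∫ x, f x ∂(Measure.pi μ) =
      ∫ y, ∫ a, f (Fin.cons a y) ∂(μ 0) ∂(Measure.pi fun i => μ (Fin.succ i)) := by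
  have hp := measurePreserving_finCons μ
  have hi := hp.integrable_comp_of_integrable hf
  rw [← hp.map_eq] at hf ⊢
  rw [integral_map hp.measurable.aemeasurable hf.aestronglyMeasurable]
  exact integral_prod_symm _ hi

theorem integrable_pi_succ {E : Type*} [MeasurableSpace E] {N : ℕ} (μ : Fin (N + 1) → Measure E)
    [∀ i, IsProbabilityMeasure (μ i)] {f : (Fin (N + 1) → E) → ℝ}
    (hf : Integrable f (Measure.pi μ)) :
    Integrable (fun y => ∫ a, f (Fin.cons a y) ∂(μ 0)) (Measure.pi fun i => μ (Fin.succ i)) :=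
  ((measurePreserving_finCons μ).integrable_comp_of_integrable hf).integral_prod_right

/-! ### Vector contraction -/

section Contraction

variable {ι : Type*} [Finite ι] [Nonempty ι] {K : ℕ}

theorem integrable_ciSup_gaussianVec (A : ι → ℝ) (c : ℝ) (u : ι → Fin K → ℝ) :
    Integrable (fun g => ⨆ k, (A k + c * ∑ j, g j * u k j)) (gaussianVec K) :=
  integrable_ciSup_finite (fun k => by fun_prop) fun k =>
    (integrable_const _).add ((integrable_gaussianVec_apply (u k)).const_mul c)

theorem integrable_ciSup_gaussianMat {N : ℕ} (A : ι → ℝ) (c : ℝ) (u : Fin N → ι → Fin K → ℝ) :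
    Integrable (fun σ => ⨆ k, (A k + c * ∑ t, ∑ j, σ t j * u t k j)) (gaussianMat N K) :=
  integrable_ciSup_finite (fun k => by fun_prop) fun k =>
    (integrable_const _).add ((integrable_gaussianMat_apply (fun t => u t k)).const_mul c)

/-- With maximizers `k`, `l`, the left side is at most `A k + A l + L * ‖u k - u l‖`, and the norm
is a Gaussian average of `|⟨g, u k - u l⟩|`. Whatever the sign of this inner product, assigning `k`
and `l` to `g` and `-g` suitably bounds the integrand by `S g + S (-g)`. Symmetry of the Gaussian
law gives the factor `2`. -/
theorem ciSup_add_ciSup_le_gaussian (A b : ι → ℝ) (u : ι → EuclideanSpace ℝ (Fin K)) {L : ℝ}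
    (hL : 0 ≤ L) (h : ∀ k l, |b k - b l| ≤ L * ‖u k - u l‖) :
    (⨆ k, (A k + b k)) + (⨆ k, (A k - b k)) ≤
      2 * ∫ g, ⨆ k, (A k + (L * √(Real.pi / 2)) * ∑ j, g j * u k j) ∂(gaussianVec K) := by
  obtain ⟨k, hk⟩ := exists_eq_ciSup_of_finite (f := fun k => A k + b k)
  obtain ⟨l, hl⟩ := exists_eq_ciSup_of_finite (f := fun k => A k - b k)
  rw [← hk, ← hl]
  set c := L * √(Real.pi / 2) with hc
  have hc0 : 0 ≤ c := by positivity
  set S : (Fin K → ℝ) → ℝ := fun g => ⨆ k, (A k + c * ∑ j, g j * u k j) with hS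
  have hSi : Integrable S (gaussianVec K) := integrable_ciSup_gaussianVec A c _
  have hSm : Measurable S := Measurable.iSup fun k => by fun_prop
  have hneg : ∫ g, S (-g) ∂(gaussianVec K) = ∫ g, S g ∂(gaussianVec K) := by
    conv_rhs => rw [← map_neg_gaussianVec K]
    rw [integral_map (by fun_prop) hSm.aestronglyMeasurable]
  have hnegi : Integrable (fun g => S (-g)) (gaussianVec K) := by
    rw [← map_neg_gaussianVec K] at hSi
    exact hSi.comp_measurable (by fun_prop)
  have hw : L * ‖u k - u l‖ = ∫ g, c * |∑ j, g j * (u k - u l) j| ∂(gaussianVec K) := by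
    rw [integral_const_mul, integral_abs_gaussianVec, hc]
    have : √(Real.pi / 2) * √(2 / Real.pi) = 1 := by
      rw [← Real.sqrt_mul (by positivity), div_mul_div_cancel₀ (by norm_num), div_self (by positivity),
        Real.sqrt_one]
    linear_combination (-L * ‖u k - u l‖) * this
  have hwi : Integrable (fun g => c * |∑ j, g j * (u k - u l) j|) (gaussianVec K) :=
    (integrable_gaussianVec_apply _).abs.const_mul c
  have h1 : ∫ g, (A k + A l + c * |∑ j, g j * (u k - u l) j|) ∂(gaussianVec K) ≤
      ∫ g, (S g + S (-g)) ∂(gaussianVec K) := by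
    refine integral_mono ((integrable_const _).add hwi) (hSi.add hnegi) fun g => ?_
    have e1 : ∑ j, g j * (u k - u l) j = ∑ j, g j * u k j - ∑ j, g j * u l j := by
      simp [mul_sub]
    have e2 : ∀ i, ∑ j, (-g) j * u i j = -∑ j, g j * u i j := fun i => by simp
    have a1 : ∀ i, A i + c * ∑ j, g j * u i j ≤ S g := fun i =>
      le_ciSup_finite (fun k => A k + c * ∑ j, g j * u k j) i
    have a2 : ∀ i, A i - c * ∑ j, g j * u i j ≤ S (-g) := fun i => by
      have := le_ciSup_finite (fun k => A k + c * ∑ j, (-g) j * u k j) i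
      simp only [e2] at this
      simp only [hS, e2]
      linarith
    dsimp only
    rw [e1]
    rcases abs_cases (∑ j, g j * u k j - ∑ j, g j * u l j) with ⟨h, -⟩ | ⟨h, -⟩ <;> rw [h]
    · linarith [a1 k, a2 l]
    · linarith [a1 l, a2 k]
  rw [integral_add hSi hnegi, hneg, integral_add (by fun_prop) hwi, ← hw] at h1
  have h2 := (abs_le.1 (h k l)).2
  simp at h1
  linarith

/-- Contraction: Rademacher averages of Lipschitz functions of vectors are dominated by Gaussian
averages of the vectors. -/
theorem rademacher_le_gaussian {L : ℝ} (hL : 0 ≤ L) {N : ℕ} : ∀ (A : ι → ℝ) (b : Fin N → ι → ℝ)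
    (u : Fin N → ι → EuclideanSpace ℝ (Fin K)),
    (∀ t k l, |b t k - b t l| ≤ L * ‖u t k - u t l‖) →
    ∑ ε : Fin N → Bool, ⨆ k, (A k + ∑ t, (if ε t then b t k else - b t k)) ≤
      2 ^ N * ∫ σ, ⨆ k, (A k + (L * √(Real.pi / 2)) * ∑ t, ∑ j, σ t j * u t k j)
        ∂(gaussianMat N K) := by
  induction N with
  | zero => intro A b u _; simp
  | succ N ih =>
    intro A b u h
    set c := L * √(Real.pi / 2) with hc
    rw [← (Fin.consEquiv fun _ => Bool).sum_comp, Fintype.sum_prod_type]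
    simp only [Fintype.univ_bool, Finset.mem_singleton, Bool.true_eq_false, not_false_eq_true,
      Finset.sum_insert, Finset.sum_singleton]
    have e : ∀ (x : Bool) (ε : Fin N → Bool) k,
        A k + ∑ t, (if (Fin.consEquiv fun _ => Bool) (x, ε) t = true then b t k else - b t k) =
        (A k + if x then b 0 k else - b 0 k) +
          ∑ t : Fin N, (if ε t then b t.succ k else - b t.succ k) := by
      intro x ε k
      rw [Fin.sum_univ_succ]
      simp [Fin.consEquiv, add_assoc]
    simp only [e]
    -- The arbitrary offset `A` absorbs the first sign here, and absorbs the remaining Gaussian sum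
    -- when the one-coordinate lemma is applied below.
    have i1 := ih (fun k => A k + b 0 k) (fun t => b t.succ) (fun t => u t.succ) fun t => h t.succ
    have i2 := ih (fun k => A k - b 0 k) (fun t => b t.succ) (fun t => u t.succ) fun t => h t.succ
    have hint := integrable_ciSup_gaussianMat A c (fun t k j => u t k j)
    have hI := integrable_pi_succ _ hint
    have i3 : ∫ σ, ((⨆ k, (A k + b 0 k + c * ∑ t, ∑ j, σ t j * u (Fin.succ t) k j)) +
        ⨆ k, (A k - b 0 k + c * ∑ t, ∑ j, σ t j * u (Fin.succ t) k j)) ∂(gaussianMat N K) ≤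
        ∫ σ, 2 * (∫ g, ⨆ k, (A k + c * ∑ t, ∑ j, (Fin.cons g σ : Fin (N + 1) → Fin K → ℝ) t j *
          u t k j) ∂(gaussianVec K)) ∂(gaussianMat N K) := by
      refine integral_mono ((integrable_ciSup_gaussianMat _ c fun t k j => u (Fin.succ t) k j).add
        (integrable_ciSup_gaussianMat _ c fun t k j => u (Fin.succ t) k j)) (hI.const_mul 2)
        fun σ => ?_
      have := ciSup_add_ciSup_le_gaussian
        (fun k => A k + c * ∑ t, ∑ j, σ t j * u (Fin.succ t) k j) (b 0) (u 0) hL (h 0)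
      simp only [Fin.sum_univ_succ, Fin.cons_zero, Fin.cons_succ]
      refine (le_of_eq ?_).trans (this.trans (le_of_eq ?_))
      · congr 1 <;> exact iSup_congr fun k => by ring
      · congr 1
        exact integral_congr_ae (ae_of_all _ fun g => iSup_congr fun k => by ring)
    rw [integral_add (integrable_ciSup_gaussianMat _ c fun t k j => u (Fin.succ t) k j)
        (integrable_ciSup_gaussianMat _ c fun t k j => u (Fin.succ t) k j),
      integral_const_mul, ← integral_pi_succ _ hint] at i3
    simp only [if_true, Bool.false_eq_true, if_false, ← sub_eq_add_neg] at i1 i2 ⊢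
    calc _ ≤ _ := add_le_add i1 i2
      _ = 2 ^ N * (_ + _) := (mul_add _ _ _).symm
      _ ≤ _ := mul_le_mul_of_nonneg_left i3 (by positivity)
      _ = _ := by ring

end Contraction

/-! ### Lower bounds for extended expectations -/

/-- Only monotonicity of `∫⁻` for the positive and negative parts is used, so `S` may be a
nonmeasurable supremum over the whole class. -/
theorem integral_le_extExpectation {Ω : Type*} [MeasurableSpace Ω] {μ : Measure Ω} {r : Ω → ℝ}
    (hr : Integrable r μ) {S : Ω → EReal} (h : ∀ ω, (r ω : EReal) ≤ S ω) :
    ((∫ ω, r ω ∂μ : ℝ) : EReal) ≤ extExpectation μ S := by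
  have h1 : ∫⁻ ω, ENNReal.ofReal (r ω) ∂μ ≠ ∞ := hr.lintegral_lt_top.ne
  have h2 : ∫⁻ ω, ENNReal.ofReal (-r ω) ∂μ ≠ ∞ := hr.neg.lintegral_lt_top.ne
  rw [integral_eq_lintegral_pos_part_sub_lintegral_neg_part hr, EReal.coe_sub,
    EReal.coe_ennreal_toReal h1, EReal.coe_ennreal_toReal h2]
  refine EReal.sub_le_sub ?_ ?_
  · refine EReal.coe_ennreal_le_coe_ennreal_iff.2 (lintegral_mono fun ω => ?_)
    have := EReal.toENNReal_le_toENNReal (h ω)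
    simpa using this
  · refine EReal.coe_ennreal_le_coe_ennreal_iff.2 (lintegral_mono fun ω => ?_)
    have := EReal.toENNReal_le_toENNReal (EReal.neg_le_neg_iff.2 (h ω))
    rw [← EReal.coe_neg] at this
    simpa using this

/-! ### Fibre sizes of a uniformly random map -/

section FiberCount

/-- The centered number of indices that `τ` sends to `t`. -/
noncomputable def fiberDev {m N : ℕ} (t : Fin N) (τ : Fin m → Fin N) : ℝ :=
  ∑ s, ((if τ s = t then 1 else 0) - 1 / (N : ℝ))

theorem card_fiber_eq {m N : ℕ} (t : Fin N) (τ : Fin m → Fin N) :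
    ((Finset.univ.filter fun s => τ s = t).card : ℝ) = m / N + fiberDev t τ := by
  simp [fiberDev, div_eq_mul_inv]

theorem sum_fiberDev_cons {m N : ℕ} (t : Fin N) (φ : ℝ → ℝ) :
    ∑ τ : Fin (m + 1) → Fin N, φ (fiberDev t τ) =
      ∑ τ : Fin m → Fin N, ∑ a : Fin N,
        φ (((if a = t then 1 else 0) - 1 / (N : ℝ)) + fiberDev t τ) := by
  rw [← (Fin.consEquiv fun _ => Fin N).sum_comp, Fintype.sum_prod_type_right]
  refine Finset.sum_congr rfl fun τ _ => Finset.sum_congr rfl fun a _ => ?_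
  congr 1
  rw [fiberDev, Fin.sum_univ_succ]
  rfl

theorem sum_indicator_sub {N : ℕ} (t : Fin N) :
    ∑ a : Fin N, ((if a = t then 1 else 0) - 1 / (N : ℝ)) = 0 := by
  have : (N : ℝ) ≠ 0 := by have := t.pos; positivity
  simp [this]

theorem sum_indicator_sub_sq_le {N : ℕ} (t : Fin N) :
    ∑ a : Fin N, ((if a = t then 1 else 0) - 1 / (N : ℝ)) ^ 2 ≤ 1 := by
  have hN : (0 : ℝ) < N := by have := t.pos; positivity
  have : ∀ a : Fin N, ((if a = t then 1 else 0) - 1 / (N : ℝ)) ^ 2 =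
      (if a = t then 1 - 2 / (N : ℝ) else 0) + 1 / (N : ℝ) ^ 2 := by
    intro a; split_ifs <;> ring
  simp_rw [this]
  rw [Finset.sum_add_distrib, Finset.sum_ite_eq' Finset.univ t]
  simp only [Finset.mem_univ, if_true, Finset.sum_const, Finset.card_univ, Fintype.card_fin,
    nsmul_eq_mul]
  have : (N : ℝ) * (1 / (N : ℝ) ^ 2) = 1 / N := by field_simp
  rw [this]
  have h2 : 0 < 1 / (N : ℝ) := by positivity
  have h3 : 2 / (N : ℝ) = 1 / N + 1 / N := by ring
  linarith

theorem sum_fiberDev {m N : ℕ} (t : Fin N) : ∑ τ : Fin m → Fin N, fiberDev t τ = 0 := by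
  induction m with
  | zero => simp [fiberDev]
  | succ m ih =>
    rw [sum_fiberDev_cons t fun x => x]
    simp_rw [Finset.sum_add_distrib, sum_indicator_sub]
    simp [← Finset.mul_sum, ih]

/-- This is the binomial variance bound `m / N`, multiplied by `N * N ^ m`: each new index adds its
own variance, and the cross term vanishes because the indicator is centered. -/
theorem sum_fiberDev_sq_le {m N : ℕ} (t : Fin N) :
    (N : ℝ) * ∑ τ : Fin m → Fin N, fiberDev t τ ^ 2 ≤ m * (N : ℝ) ^ m := by
  induction m with
  | zero => simp [fiberDev]
  | succ m ih =>
    rw [sum_fiberDev_cons t fun x => x ^ 2]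
    have : ∀ τ : Fin m → Fin N,
        ∑ a : Fin N, (((if a = t then 1 else 0) - 1 / (N : ℝ)) + fiberDev t τ) ^ 2 =
        ∑ a : Fin N, ((if a = t then 1 else 0) - 1 / (N : ℝ)) ^ 2 + N * fiberDev t τ ^ 2 := by
      intro τ
      simp_rw [add_sq, Finset.sum_add_distrib, mul_assoc, ← Finset.mul_sum, ← Finset.sum_mul,
        sum_indicator_sub]
      simp
    simp_rw [this]
    rw [Finset.sum_add_distrib, ← Finset.mul_sum, Finset.sum_const, Finset.card_univ]
    simp only [Fintype.card_fun, Fintype.card_fin, nsmul_eq_mul]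
    push_cast
    have h1 : (N : ℝ) ^ m * ∑ a : Fin N, ((if a = t then 1 else 0) - 1 / (N : ℝ)) ^ 2 ≤
        (N : ℝ) ^ m * 1 := mul_le_mul_of_nonneg_left (sum_indicator_sub_sq_le t) (by positivity)
    have h2 := add_le_add h1 ih
    have h3 := mul_le_mul_of_nonneg_left h2 (Nat.cast_nonneg (α := ℝ) N)
    calc _ ≤ _ := h3
      _ = _ := by ring

/-- For `z = s ^ 2` the difference of the two sides is `(s - 1) ^ 2 * s * (s + 2) / 2`. -/
theorem sqrt_ge_quadratic {z : ℝ} (hz : 0 ≤ z) : 1 + (z - 1) / 2 - (z - 1) ^ 2 / 2 ≤ √z := by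
  obtain ⟨s, hs, rfl⟩ : ∃ s, 0 ≤ s ∧ z = s ^ 2 := ⟨√z, Real.sqrt_nonneg _, (Real.sq_sqrt hz).symm⟩
  rw [Real.sqrt_sq hs]
  nlinarith [mul_nonneg (sq_nonneg (s - 1)) (mul_nonneg hs (by linarith : (0 : ℝ) ≤ s + 2)),
    sq_nonneg (s - 1)]

/-- Apply the quadratic minorant of the square root at the ratio of the fibre size to its mean `μ =
m / N`. On average the linear term vanishes, and the variance bound makes the relative loss at most
`1 / (2 * μ)`. -/
theorem sum_sqrt_card_fiber_ge {m N : ℕ} (hm : 1 ≤ m) (t : Fin N) :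
    (N : ℝ) ^ m * (√(m / N : ℝ) * (1 - N / (2 * m))) ≤
      ∑ τ : Fin m → Fin N, √((Finset.univ.filter fun s => τ s = t).card : ℝ) := by
  have hN : (0 : ℝ) < N := by have := t.pos; positivity
  have hm' : (0 : ℝ) < m := by positivity
  set μ : ℝ := m / N with hμ
  have hμ0 : 0 < μ := by positivity
  have h1 : ∀ τ : Fin m → Fin N,
      √μ * (1 + fiberDev t τ * (1 / (2 * μ)) - fiberDev t τ ^ 2 * (1 / (2 * μ ^ 2))) ≤
      √((Finset.univ.filter fun s => τ s = t).card : ℝ) := by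
    intro τ
    have hc := card_fiber_eq t τ
    have h0 : (0 : ℝ) ≤ ((Finset.univ.filter fun s => τ s = t).card : ℝ) := Nat.cast_nonneg _
    rw [hc] at h0 ⊢
    rw [← hμ] at h0 ⊢
    have h2 := sqrt_ge_quadratic (div_nonneg h0 hμ0.le)
    have h3 : √(μ + fiberDev t τ) = √μ * √((μ + fiberDev t τ) / μ) := by
      rw [← Real.sqrt_mul hμ0.le, mul_div_cancel₀ _ hμ0.ne']
    rw [h3]
    refine mul_le_mul_of_nonneg_left (le_trans (le_of_eq ?_) h2) (Real.sqrt_nonneg _)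
    field_simp
    ring
  refine le_trans ?_ (Finset.sum_le_sum fun τ _ => h1 τ)
  rw [← Finset.mul_sum, Finset.sum_sub_distrib, Finset.sum_add_distrib, ← Finset.sum_mul,
    ← Finset.sum_mul, sum_fiberDev]
  simp only [Finset.sum_const, Finset.card_univ, Fintype.card_fun, Fintype.card_fin, nsmul_eq_mul,
    mul_one, zero_mul, add_zero]
  rw [mul_left_comm]
  refine mul_le_mul_of_nonneg_left ?_ (Real.sqrt_nonneg _)
  have h2 := mul_le_mul_of_nonneg_right (sum_fiberDev_sq_le (m := m) t)
    (by positivity : 0 ≤ (N : ℝ)⁻¹ * (1 / (2 * μ ^ 2)))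
  have h3 : (m * (N : ℝ) ^ m) * ((N : ℝ)⁻¹ * (1 / (2 * μ ^ 2))) = N ^ m * (N / (2 * m)) := by
    rw [hμ]; field_simp
  have h4 : ((N : ℝ) * ∑ τ : Fin m → Fin N, fiberDev t τ ^ 2) * ((N : ℝ)⁻¹ * (1 / (2 * μ ^ 2))) =
      (∑ τ : Fin m → Fin N, fiberDev t τ ^ 2) * (1 / (2 * μ ^ 2)) := by
    field_simp
  rw [h3, h4] at h2
  push_cast
  linarith

theorem sum_sqrt_card_fiber_eq {m N : ℕ} (t t' : Fin N) :
    ∑ τ : Fin m → Fin N, √((Finset.univ.filter fun s => τ s = t).card : ℝ) =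
      ∑ τ : Fin m → Fin N, √((Finset.univ.filter fun s => τ s = t').card : ℝ) := by
  rw [← ((Equiv.refl (Fin m)).arrowCongr (Equiv.swap t t')).sum_comp]
  refine Finset.sum_congr rfl fun τ _ => ?_
  congr 3
  ext s
  simp [Equiv.swap_apply_eq_iff]

end FiberCount

/-! ### From i.i.d. complexity to arbitrary fixed points -/

section WorstCase

variable {X Z : Type*} [MeasurableSpace X] {K : ℕ} {ι : Type*} [Finite ι] [Nonempty ι]

theorem integral_ciSup_le_gaussianComplexity {𝓕 : Set (Z → EuclideanSpace ℝ (Fin K))}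
    {𝓗 : Set (X → Z)} {f : ι → Z → EuclideanSpace ℝ (Fin K)} {h : ι → X → Z}
    (hf : ∀ k, f k ∈ 𝓕) (hh : ∀ k, h k ∈ 𝓗) (Q : ProbabilityMeasure X) (m : ℕ)
    (hint : Integrable (fun x : Fin m → X => ∫ σ, ⨆ k, ∑ s, ∑ j, σ s j * f k (h k (x s)) j
      ∂(gaussianMat m K)) (iidLaw Q m)) :
    ((∫ x : Fin m → X, ∫ σ, ⨆ k, ∑ s, ∑ j, σ s j * f k (h k (x s)) j ∂(gaussianMat m K)
      ∂(iidLaw Q m) : ℝ) : EReal) ≤ gaussianComplexity 𝓕 𝓗 Q m := by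
  refine integral_le_extExpectation hint fun x => ?_
  refine integral_le_extExpectation (integrable_ciSup_finite (fun k => by fun_prop) fun k =>
    integrable_gaussianMat_apply fun s => f k (h k (x s))) fun σ => ?_
  obtain ⟨k, hk⟩ := exists_eq_ciSup_of_finite
    (f := fun k => ∑ s, ∑ j, σ s j * f k (h k (x s)) j)
  rw [← hk]
  exact le_iSup₂_of_le (f k) (hf k) (le_iSup₂_of_le (h k) (hh k) le_rfl)

/-- Take for `Q` the empirical law of the points: `m` draws from it are `x ∘ τ` for a uniformly
random map `τ`. -/
theorem integral_iidLaw_map_uniform {N m : ℕ} [NeZero N] (x : Fin N → X) {φ : (Fin m → X) → ℝ}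
    (hφ : Measurable φ) : ∃ Q : ProbabilityMeasure X, Integrable φ (iidLaw Q m) ∧
      ∫ y, φ y ∂(iidLaw Q m) = ((N : ℝ) ^ m)⁻¹ * ∑ τ : Fin m → Fin N, φ (x ∘ τ) := by
  set ν : Measure (Fin N) := uniformOn Set.univ with hν
  have : IsProbabilityMeasure ν := isProbabilityMeasure_uniformOn Set.finite_univ Set.univ_nonempty
  have hx : Measurable x := measurable_of_finite x
  have hQ : IsProbabilityMeasure (ν.map x) := Measure.isProbabilityMeasure_map hx.aemeasurable
  refine ⟨⟨ν.map x, hQ⟩, ?_⟩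
  have e : iidLaw ⟨ν.map x, hQ⟩ m = (Measure.pi fun _ : Fin m => ν).map fun τ => x ∘ τ :=
    (Measure.pi_map_pi (μ := fun _ : Fin m => ν) (f := fun _ => x) fun _ => hx.aemeasurable).symm
  have hm : Measurable fun τ : Fin m → Fin N => x ∘ τ := measurable_of_finite _
  rw [e]
  refine ⟨(integrable_map_measure hφ.aestronglyMeasurable hm.aemeasurable).2 .of_finite, ?_⟩
  rw [integral_map hm.aemeasurable hφ.aestronglyMeasurable, integral_fintype .of_finite,
    Finset.mul_sum]
  refine Finset.sum_congr rfl fun τ _ => ?_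
  have : ∀ a, ν {a} = (N : ℝ≥0∞)⁻¹ := fun a => by
    rw [hν, uniformOn_univ]; simp
  rw [Measure.real, Measure.pi_singleton]
  simp [this]

/-- A bound on the Gaussian complexity for all laws of the sample points bounds the
Gaussian averages over every fixed set of points. -/
theorem gaussian_average_le {𝓕 : Set (Z → EuclideanSpace ℝ (Fin K))} {𝓗 : Set (X → Z)} {G : ℝ}
    (hG : ∀ (Q : ProbabilityMeasure X) (m : ℕ), 1 ≤ m →
      gaussianComplexity 𝓕 𝓗 Q m ≤ ((G * √(m : ℝ) : ℝ) : EReal))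
    {f : ι → Z → EuclideanSpace ℝ (Fin K)} {h : ι → X → Z}
    (hf : ∀ k, f k ∈ 𝓕) (hh : ∀ k, h k ∈ 𝓗) (hfh : ∀ k, Measurable fun x => f k (h k x))
    {N : ℕ} (hN : 1 ≤ N) (x : Fin N → X) :
    ∫ σ, ⨆ k, ∑ t, ∑ j, σ t j * f k (h k (x t)) j ∂(gaussianMat N K) ≤ G * √N := by
  have : NeZero N := ⟨by omega⟩
  have hN0 : (0 : ℝ) < N := by positivity
  set a : Fin N → ι → Fin K → ℝ := fun t k j => f k (h k (x t)) j with ha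
  have hint : ∀ w : Fin N → ℝ, Integrable (fun σ : Fin N → Fin K → ℝ =>
      ⨆ k, ∑ t, ∑ j, (w t * σ t j) * a t k j) (gaussianMat N K) := fun w =>
    integrable_ciSup_finite (fun k => by fun_prop) fun k => by
      simpa [mul_comm, mul_left_comm, mul_assoc] using
        integrable_gaussianMat_apply (m := N) (K := K) fun t j => w t * a t k j
  set I := ∫ σ, ⨆ k, ∑ t, ∑ j, σ t j * a t k j ∂(gaussianMat N K) with hI
  have hint1 : Integrable (fun σ : Fin N → Fin K → ℝ =>
      ⨆ k, ∑ t, ∑ j, σ t j * a t k j) (gaussianMat N K) := by simpa using hint fun _ => 1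
  have hI0 : 0 ≤ I := by
    obtain ⟨k⟩ := ‹Nonempty ι›
    rw [← integral_gaussianMat_apply fun t => a t k]
    exact integral_mono (integrable_gaussianMat_apply _) hint1 fun σ =>
      le_ciSup_finite (fun k => ∑ t, ∑ j, σ t j * a t k j) k
  have step : ∀ m : ℕ, 1 ≤ m → (1 - N / (2 * m)) * I ≤ G * √N := by
    intro m hm
    have hm0 : (0 : ℝ) < m := by positivity
    set φ : (Fin m → X) → ℝ := fun y => ∫ σ, ⨆ k, ∑ s, ∑ j, σ s j * f k (h k (y s)) j
      ∂(gaussianMat m K) with hφ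
    have hφm : Measurable φ := by
      have : Measurable fun p : (Fin m → X) × (Fin m → Fin K → ℝ) =>
          ⨆ k, ∑ s, ∑ j, p.2 s j * f k (h k (p.1 s)) j := by
        refine Measurable.iSup fun k => Finset.measurable_sum _ fun s _ =>
          Finset.measurable_sum _ fun j _ => Measurable.mul (by fun_prop) ?_
        have h1 : Measurable fun p : (Fin m → X) × (Fin m → Fin K → ℝ) => p.1 s := by fun_prop
        have h2 := (hfh k).comp h1
        have h3 : Measurable fun v : EuclideanSpace ℝ (Fin K) => v j := by fun_prop
        exact h3.comp h2
      exact this.stronglyMeasurable.integral_prod_right.measurable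
    obtain ⟨Q, hQi, hQ⟩ := integral_iidLaw_map_uniform x hφm
    have h1 := (integral_ciSup_le_gaussianComplexity hf hh Q m hQi).trans (hG Q m hm)
    rw [EReal.coe_le_coe_iff] at h1
    change ∫ y, φ y ∂(iidLaw Q m) ≤ _ at h1
    rw [hQ] at h1
    -- The Gaussians sitting on copies of the same point are pooled into one, scaled by the square
    -- root of the multiplicity.
    have h2 : ∀ τ : Fin m → Fin N, φ (x ∘ τ) = ∫ g, ⨆ k, ∑ t, ∑ j,
        (√((Finset.univ.filter fun s => τ s = t).card : ℝ) * g t j) * a t k j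
          ∂(gaussianMat N K) := by
      intro τ
      have hm1 : Measurable (fun (σ : Fin m → Fin K → ℝ) (t : Fin N) (j : Fin K) =>
          ∑ s, if τ s = t then σ s j else 0) := by
        refine measurable_pi_lambda _ fun t => measurable_pi_lambda _ fun j =>
          Finset.measurable_sum _ fun s _ => ?_
        split_ifs <;> fun_prop
      have hm2 : Measurable (fun (g : Fin N → Fin K → ℝ) (t : Fin N) (j : Fin K) =>
          √(((Finset.univ.filter fun s => τ s = t).card : ℝ)) * g t j) := by fun_prop
      have hm3 : Measurable fun v : Fin N → Fin K → ℝ => ⨆ k, ∑ t, ∑ j, v t j * a t k j :=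
        Measurable.iSup fun k => by fun_prop
      have e1 := integral_map (μ := gaussianMat m K) hm1.aemeasurable hm3.aestronglyMeasurable
      have e2 := integral_map (μ := gaussianMat N K) hm2.aemeasurable hm3.aestronglyMeasurable
      rw [map_fiberSum_gaussianMat, e2] at e1
      rw [e1, hφ]
      refine integral_congr_ae (ae_of_all _ fun σ => iSup_congr fun k => ?_)
      simp only [Function.comp_apply, Finset.sum_mul, ite_mul, zero_mul]
      rw [← Finset.sum_fiberwise_of_maps_to (t := Finset.univ) (g := τ)
        fun _ _ => Finset.mem_univ _]
      refine Finset.sum_congr rfl fun t _ => ?_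
      rw [Finset.sum_comm]
      refine Finset.sum_congr rfl fun j _ => ?_
      rw [Finset.sum_filter]
      refine Finset.sum_congr rfl fun s _ => ?_
      split_ifs with hs
      · simp [ha, hs]
      · simp
    simp_rw [h2] at h1
    rw [← integral_finsetSum _ fun τ _ => hint _] at h1
    set R := ∑ τ : Fin m → Fin N, √((Finset.univ.filter fun s => τ s = 0).card : ℝ) with hR
    have h3 : R * I ≤ ∫ g, ∑ τ : Fin m → Fin N, ⨆ k, ∑ t, ∑ j,
        (√((Finset.univ.filter fun s => τ s = t).card : ℝ) * g t j) * a t k j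
          ∂(gaussianMat N K) := by
      rw [hI, ← integral_const_mul]
      refine integral_mono (hint1.const_mul R) (integrable_finsetSum _ fun τ _ => hint _)
        fun g => ?_
      -- The maximizer for the unweighted sum is used for every `τ`. Summed over `τ`, all points
      -- receive the same weight `R`, by `sum_sqrt_card_fiber_eq`.
      obtain ⟨k, hk⟩ := exists_eq_ciSup_of_finite (f := fun k => ∑ t, ∑ j, g t j * a t k j)
      dsimp only
      rw [← hk]
      refine le_trans (le_of_eq ?_) (Finset.sum_le_sum fun τ _ => le_ciSup_finite (fun k =>
        ∑ t, ∑ j, (√((Finset.univ.filter fun s => τ s = t).card : ℝ) * g t j) * a t k j) k)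
      rw [Finset.mul_sum]
      refine Eq.trans (Finset.sum_congr rfl fun t _ => ?_) Finset.sum_comm
      simp_rw [mul_assoc, ← Finset.mul_sum]
      rw [← Finset.sum_mul, hR, sum_sqrt_card_fiber_eq 0 t]
    have h4 := sum_sqrt_card_fiber_ge hm (0 : Fin N)
    have h5 := (mul_le_mul_of_nonneg_right h4 hI0).trans h3
    have h6 := (mul_le_mul_of_nonneg_left h5
      (by positivity : 0 ≤ ((N : ℝ) ^ m)⁻¹)).trans h1
    have h7 : ((N : ℝ) ^ m)⁻¹ * ((N : ℝ) ^ m * (√(m / N : ℝ) * (1 - N / (2 * m))) * I) =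
        √m / √N * ((1 - N / (2 * m)) * I) := by
      rw [Real.sqrt_div hm0.le]
      field_simp
    rw [h7, div_mul_eq_mul_div, div_le_iff₀ (by positivity)] at h6
    have h8 : 0 < √(m : ℝ) := by positivity
    refine le_of_mul_le_mul_left ?_ h8
    linarith
  -- The sample size `m` is free; the loss from uneven multiplicities disappears in the limit.
  have hlim : Tendsto (fun m : ℕ => (1 - (N : ℝ) / (2 * m)) * I) atTop (𝓝 ((1 - 0) * I)) := by
    refine (tendsto_const_nhds.sub ?_).mul_const I
    exact tendsto_const_nhds.div_atTop
      (tendsto_natCast_atTop_atTop.const_mul_atTop (by norm_num : (0 : ℝ) < 2))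
  have := le_of_tendsto hlim ((eventually_ge_atTop 1).mono fun m hm => step m hm)
  simpa using this

end WorstCase

/-! ### McDiarmid's inequality -/

section McDiarmid

theorem abs_integral_le_of_abs_le {Ω : Type*} [MeasurableSpace Ω] (μ : Measure Ω)
    [IsProbabilityMeasure μ] {f : Ω → ℝ} {M : ℝ} (h : ∀ x, |f x| ≤ M) : |∫ x, f x ∂μ| ≤ M := by
  have := norm_integral_le_of_norm_le_const (μ := μ) (f := f) (C := M) (ae_of_all _ h)
  simpa using this

theorem abs_sub_le_sum_of_abs_sub_update_le {E ι : Type*} [Fintype ι] [DecidableEq ι]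
    {f : (ι → E) → ℝ} {c : ι → ℝ}
    (hc : ∀ i x y, |f x - f (Function.update x i y)| ≤ c i) (x y : ι → E) :
    |f x - f y| ≤ ∑ i, c i := by
  have key : ∀ s : Finset ι, |f x - f (s.piecewise y x)| ≤ ∑ i ∈ s, c i := by
    intro s
    induction s using Finset.induction_on with
    | empty => simp
    | insert i s hi ih =>
      rw [Finset.sum_insert hi, Finset.piecewise_insert]
      have := hc i (s.piecewise y x) (y i)
      calc _ ≤ |f x - f (s.piecewise y x)| + _ := abs_sub_le _ (f (s.piecewise y x)) _
        _ ≤ _ := by linarith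
  simpa using key Finset.univ

variable {E : Type*} [MeasurableSpace E]

theorem integrable_of_abs_sub_update_le {ι : Type*} [Fintype ι] [DecidableEq ι]
    {μ : Measure (ι → E)} [IsFiniteMeasure μ] {f : (ι → E) → ℝ} (hf : Measurable f) {c : ι → ℝ}
    (hc : ∀ i x y, |f x - f (Function.update x i y)| ≤ c i) : Integrable f μ := by
  rcases isEmpty_or_nonempty (ι → E) with h | ⟨⟨x₀⟩⟩
  · exact ⟨hf.aestronglyMeasurable, by simp [HasFiniteIntegral, Measure.eq_zero_of_isEmpty]⟩
  · refine .of_bound hf.aestronglyMeasurable (|f x₀| + ∑ i, c i) (ae_of_all _ fun x => ?_)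
    have := abs_sub_le_sum_of_abs_sub_update_le hc x x₀
    rw [Real.norm_eq_abs]
    have := abs_sub_abs_le_abs_sub (f x) (f x₀)
    linarith

/-- McDiarmid's inequality: a function with bounded differences of independent variables is
sub-Gaussian. -/
theorem hasSubgaussianMGF_of_abs_sub_update_le {N : ℕ} : ∀ (μ : Fin N → Measure E)
    [∀ i, IsProbabilityMeasure (μ i)] {f : (Fin N → E) → ℝ} (_ : Measurable f) {c : Fin N → ℝ}
    (_ : ∀ i x y, |f x - f (Function.update x i y)| ≤ c i),
    HasSubgaussianMGF (fun x => f x - ∫ y, f y ∂(Measure.pi μ)) (∑ i, (‖c i‖₊ / 2) ^ 2)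
      (Measure.pi μ) := by
  induction N with
  | zero =>
    intro μ _ f hf c hc
    have : (fun x => f x - ∫ y, f y ∂(Measure.pi μ)) = fun _ => 0 := by
      ext x
      have : ∀ y, f y = f x := fun y => by rw [Subsingleton.elim x y]
      simp [this]
    rw [this]
    simp
  | succ N ih =>
    intro μ _ f hf c hc
    have hne : Nonempty E := nonempty_of_isProbabilityMeasure (μ 0)
    have hfi : Integrable f (Measure.pi μ) := integrable_of_abs_sub_update_le hf hc
    -- Averaging out the first coordinate preserves the mean and the other difference bounds, so the
    -- induction hypothesis applies to `g`.
    set g : (Fin N → E) → ℝ := fun y => ∫ a, f (Fin.cons a y) ∂(μ 0) with hg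
    have hcons := (measurePreserving_finCons μ).measurable
    have hgm : Measurable g :=
      (hf.comp hcons).stronglyMeasurable.integral_prod_left'.measurable
    have hfm : ∀ y, Measurable fun a => f (Fin.cons a y) := fun y =>
      hf.comp (hcons.comp (measurable_id.prodMk measurable_const))
    have hc' : ∀ y a a', |f (Fin.cons a y) - f (Fin.cons a' y)| ≤ c 0 := fun y a a' => by
      have := hc 0 (Fin.cons a y) a'
      rwa [Fin.update_cons_zero] at this
    have hfyi : ∀ y, Integrable (fun a => f (Fin.cons a y)) (μ 0) := fun y => by
      obtain ⟨a₀⟩ := hne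
      refine .of_bound (hfm y).aestronglyMeasurable (|f (Fin.cons a₀ y)| + c 0)
        (ae_of_all _ fun a => ?_)
      have := hc' y a a₀
      rw [Real.norm_eq_abs]
      have := abs_sub_abs_le_abs_sub (f (Fin.cons a y)) (f (Fin.cons a₀ y))
      linarith
    have hgc : ∀ i y z, |g y - g (Function.update y i z)| ≤ c (Fin.succ i) := by
      intro i y z
      rw [hg]
      dsimp only
      rw [← integral_sub (hfyi _) (hfyi _)]
      refine abs_integral_le_of_abs_le _ fun a => ?_
      rw [Fin.cons_update]
      exact hc (Fin.succ i) _ z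
    have hI := ih (fun i => μ (Fin.succ i)) hgm hgc
    have hfg : ∫ y, g y ∂(Measure.pi fun i => μ (Fin.succ i)) = ∫ x, f x ∂(Measure.pi μ) :=
      (integral_pi_succ μ hfi).symm
    rw [hfg] at hI
    set e := ∫ x, f x ∂(Measure.pi μ) with he
    have hint : ∀ t : ℝ, Integrable (fun x => Real.exp (t * (f x - e))) (Measure.pi μ) := by
      intro t
      obtain ⟨x₀⟩ : Nonempty (Fin (N + 1) → E) := inferInstance
      refine .of_bound (by fun_prop) (Real.exp (|t| * (|f x₀ - e| + ∑ i, c i)))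
        (ae_of_all _ fun x => ?_)
      rw [Real.norm_eq_abs, Real.abs_exp, Real.exp_le_exp]
      have h1 := abs_sub_le_sum_of_abs_sub_update_le hc x x₀
      have h2 : |f x - e| ≤ |f x₀ - e| + ∑ i, c i := by
        have := abs_sub_le (f x) (f x₀) e
        linarith
      calc t * (f x - e) ≤ |t * (f x - e)| := le_abs_self _
        _ = |t| * |f x - e| := abs_mul _ _
        _ ≤ _ := mul_le_mul_of_nonneg_left h2 (abs_nonneg t)
    refine ⟨hint, fun t => ?_⟩
    -- Hoeffding's lemma in the first coordinate, whose values lie within `c 0` of their infimum.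
    -- The bound is uniform in `y`, so the variance proxies add.
    have hH : ∀ y, HasSubgaussianMGF (fun a => f (Fin.cons a y) - g y) ((‖c 0‖₊ / 2) ^ 2) (μ 0) := by
      intro y
      have hb : BddBelow (Set.range fun a => f (Fin.cons a y)) := by
        obtain ⟨a₀⟩ := hne
        refine ⟨f (Fin.cons a₀ y) - c 0, ?_⟩
        rintro _ ⟨a, rfl⟩
        have := (abs_le.1 (hc' y a₀ a)).2
        dsimp only
        linarith
      have := hasSubgaussianMGF_of_mem_Icc (μ := μ 0) (X := fun a => f (Fin.cons a y))
        (a := ⨅ a, f (Fin.cons a y)) (b := (⨅ a, f (Fin.cons a y)) + c 0) (hfm y).aemeasurable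
        (ae_of_all _ fun a => ⟨ciInf_le hb a, ?_⟩)
      · rwa [add_sub_cancel_left] at this
      · rw [← sub_le_iff_le_add]
        refine le_ciInf fun a' => ?_
        have := (abs_le.1 (hc' y a a')).2
        linarith
    rw [mgf, integral_pi_succ μ (hint t)]
    have hb : ∀ y, ∫ a, Real.exp (t * (f (Fin.cons a y) - e)) ∂(μ 0) ≤
        Real.exp (((‖c 0‖₊ / 2) ^ 2 : ℝ≥0) * t ^ 2 / 2) * Real.exp (t * (g y - e)) := by
      intro y
      have := (hH y).mgf_le t
      rw [mgf] at this
      have e1 : ∀ a, Real.exp (t * (f (Fin.cons a y) - e)) =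
          Real.exp (t * (f (Fin.cons a y) - g y)) * Real.exp (t * (g y - e)) := fun a => by
        rw [← Real.exp_add]; ring_nf
      simp_rw [e1]
      rw [integral_mul_const]
      exact mul_le_mul_of_nonneg_right this (Real.exp_nonneg _)
    refine (integral_mono (integrable_pi_succ μ (hint t))
      ((hI.integrable_exp_mul t).const_mul _) hb).trans ?_
    rw [integral_const_mul]
    have := hI.mgf_le t
    rw [mgf] at this
    refine (mul_le_mul_of_nonneg_left this (Real.exp_nonneg _)).trans (le_of_eq ?_)
    rw [← Real.exp_add, Fin.sum_univ_succ]
    congr 1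
    push_cast
    ring

end McDiarmid

/-! ### Symmetrization -/

section Symmetrization

variable {X : Type*} [MeasurableSpace X] {ι : Type*} [Finite ι] [Nonempty ι]

/-- Symmetrization: the expected maximal deviation of empirical sums is at most twice a bound on
the Rademacher averages. -/
theorem integral_ciSup_deviation_le {N : ℕ} (μ : Fin N → Measure X)
    [∀ t, IsProbabilityMeasure (μ t)] {φ : Fin N → ι → X → ℝ} (hφ : ∀ t k, Measurable (φ t k))
    {M : ℝ} (hM : ∀ t k x, |φ t k x| ≤ M) {B : ℝ}
    (hB : ∀ x : Fin N → X, ∑ ε : Fin N → Bool,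
      ⨆ k, ∑ t, (if ε t then φ t k (x t) else - φ t k (x t)) ≤ 2 ^ N * B) :
    ∫ x, ⨆ k, ∑ t, (∫ y, φ t k y ∂(μ t) - φ t k (x t)) ∂(Measure.pi μ) ≤ 2 * B := by
  have hφi : ∀ t k, Integrable (φ t k) (μ t) := fun t k =>
    .of_bound (hφ t k).aestronglyMeasurable M (ae_of_all _ (hM t k))
  set H : (Fin N → X × X) → ℝ := fun z => ⨆ k, ∑ t, (φ t k (z t).2 - φ t k (z t).1) with hH
  have hHm : Measurable H := Measurable.iSup fun k => Finset.measurable_sum _ fun t _ =>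
    ((hφ t k).comp (by fun_prop)).sub ((hφ t k).comp (by fun_prop))
  have hbd : ∀ s : Fin N → ι → ℝ, (∀ t k, |s t k| ≤ 2 * M) → |⨆ k, ∑ t, s t k| ≤ N * (2 * M) := by
    intro s hs
    obtain ⟨k, hk⟩ := exists_eq_ciSup_of_finite (f := fun k => ∑ t, s t k)
    rw [← hk]
    refine (Finset.abs_sum_le_sum_abs _ _).trans ((Finset.sum_le_sum fun t _ => hs t k).trans ?_)
    simp
  have hdiff : ∀ t k (x y : X), |φ t k x - φ t k y| ≤ 2 * M := fun t k x y => by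
    have := abs_sub (φ t k x) (φ t k y)
    linarith [hM t k x, hM t k y]
  set π := Measure.pi fun t => (μ t).prod (μ t) with hπ
  have hHi : Integrable H π :=
    .of_bound hHm.aestronglyMeasurable (N * (2 * M)) (ae_of_all _ fun z =>
      hbd _ fun t k => hdiff t k _ _)
  have hmp := (measurePreserving_arrowProdEquivProdArrow X X (Fin N) μ μ).symm
  have hHi2 := hmp.integrable_comp_of_integrable hHi
  -- Jensen with a ghost sample: the supremum of an expectation is at most the expectation of the
  -- supremum.
  have h1 : ∫ x, ⨆ k, ∑ t, (∫ y, φ t k y ∂(μ t) - φ t k (x t)) ∂(Measure.pi μ) ≤ ∫ z, H z ∂π := by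
    rw [← hmp.integral_comp' H]
    refine le_trans (integral_mono ?_ hHi2.integral_prod_left fun x => ?_)
      (le_of_eq (integral_prod _ hHi2).symm)
    · refine .of_bound (Measurable.aestronglyMeasurable (Measurable.iSup fun k =>
        Finset.measurable_sum _ fun t _ => ((hφ t k).comp (by fun_prop)).const_sub _))
        (N * (2 * M)) (ae_of_all _ fun x => hbd _ fun t k => ?_)
      have h2 : |∫ y, φ t k y ∂(μ t)| ≤ M :=
        abs_integral_le_of_abs_le _ (hM t k)
      have := abs_sub (∫ y, φ t k y ∂(μ t)) (φ t k (x t))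
      linarith [hM t k (x t)]
    · obtain ⟨k, hk⟩ := exists_eq_ciSup_of_finite
        (f := fun k => ∑ t, (∫ y, φ t k y ∂(μ t) - φ t k (x t)))
      dsimp only
      rw [← hk]
      have hei : ∀ t, Integrable (fun y : Fin N → X => φ t k (y t)) (Measure.pi μ) := fun t =>
        (measurePreserving_eval μ t).integrable_comp_of_integrable (hφi t k)
      have hei' : ∀ t, Integrable (fun y : Fin N → X => φ t k (y t) - φ t k (x t))
          (Measure.pi μ) := fun t => (hei t).sub (integrable_const _)
      have e1 : ∑ t, (∫ y, φ t k y ∂(μ t) - φ t k (x t)) =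
          ∫ y : Fin N → X, ∑ t, (φ t k (y t) - φ t k (x t)) ∂(Measure.pi μ) := by
        rw [integral_finsetSum _ fun t _ => hei' t]
        refine Finset.sum_congr rfl fun t _ => ?_
        rw [integral_sub (hei t) (integrable_const _)]
        congr 1
        · have := (measurePreserving_eval μ t).map_eq
          rw [← this, integral_map (measurable_pi_apply t).aemeasurable (by rw [this]; exact (hφi t k).1)]
        · simp
      rw [e1]
      refine integral_mono (integrable_finsetSum _ fun t _ => hei' t) ?_ fun y =>
        le_ciSup_finite (fun k => ∑ t, (φ t k (y t) - φ t k (x t))) k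
      have hm : Measurable fun y : Fin N → X => ⨆ k, ∑ t, (φ t k (y t) - φ t k (x t)) :=
        Measurable.iSup fun k => Finset.measurable_sum _ fun t _ =>
          ((hφ t k).comp (measurable_pi_apply t)).sub_const _
      exact Integrable.of_bound hm.aestronglyMeasurable (N * (2 * M))
        (ae_of_all _ fun y => hbd _ fun t k => hdiff t k _ _)
  have hsw : ∀ ε : Fin N → Bool, MeasurePreserving
      (fun (z : Fin N → X × X) t => if ε t then z t else (z t).swap) π π := by
    intro ε
    have := measurePreserving_pi (fun t => (μ t).prod (μ t)) (fun t => (μ t).prod (μ t))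
      (f := fun t p => if ε t then p else p.swap) fun t => by
        cases ε t
        · simpa using Measure.measurePreserving_swap
        · simpa using! MeasurePreserving.id _
    exact this
  have hswi : ∀ ε : Fin N → Bool,
      Integrable (fun z => H fun t => if ε t then z t else (z t).swap) π := fun ε =>
    (hsw ε).integrable_comp_of_integrable hHi
  have h2 : (2 : ℝ) ^ N * ∫ z, H z ∂π ≤ 2 ^ N * (2 * B) := by
    have e1 : (2 : ℝ) ^ N * ∫ z, H z ∂π = ∫ z, ∑ ε : Fin N → Bool,
        H (fun t => if ε t then z t else (z t).swap) ∂π := by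
      rw [integral_finsetSum _ fun ε _ => hswi ε]
      have : ∀ ε : Fin N → Bool, ∫ z, H (fun t => if ε t then z t else (z t).swap) ∂π =
          ∫ z, H z ∂π := fun ε => by
        conv_rhs => rw [← (hsw ε).map_eq]
        rw [integral_map (hsw ε).measurable.aemeasurable hHm.aestronglyMeasurable]
      simp [this]
    rw [e1]
    have hp : ∀ z : Fin N → X × X, ∑ ε : Fin N → Bool,
        H (fun t => if ε t then z t else (z t).swap) ≤ 2 ^ N * (2 * B) := by
      intro z
      have b1 := hB fun t => (z t).2
      have b2 := hB fun t => (z t).1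
      -- Flipping all signs permutes the sign patterns, so the first sample, which enters with the
      -- opposite sign, obeys the same bound.
      rw [← (Equiv.arrowCongr (Equiv.refl (Fin N)) Equiv.boolNot).sum_comp] at b2
      have b := add_le_add b1 b2
      rw [← Finset.sum_add_distrib] at b
      refine le_trans (Finset.sum_le_sum fun ε _ => ?_) (b.trans (le_of_eq (by ring)))
      refine ciSup_le fun k => ?_
      refine le_trans (le_of_eq ?_) (add_le_add
        (le_ciSup_finite (fun k => ∑ t, if ε t then φ t k (z t).2 else - φ t k (z t).2) k)
        (le_ciSup_finite (fun k => ∑ t, if (Equiv.arrowCongr (Equiv.refl (Fin N))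
          Equiv.boolNot) ε t then φ t k (z t).1 else - φ t k (z t).1) k))
      rw [← Finset.sum_add_distrib]
      refine Finset.sum_congr rfl fun t _ => ?_
      cases h : ε t <;> simp [h] <;> ring
    refine (integral_mono (integrable_finsetSum _ fun ε _ => hswi ε) (integrable_const _) hp).trans ?_
    simp
  exact h1.trans (le_of_mul_le_mul_left h2 (by positivity))

end Symmetrization

/-! ### Uniform deviations of independent bounded variables -/

section FlatConcentration

variable {X : Type*} [MeasurableSpace X] {ι : Type*} [Finite ι] [Nonempty ι]

theorem abs_ciSup_sub_ciSup_le {a b : ι → ℝ} {c : ℝ} (h : ∀ k, |a k - b k| ≤ c) :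
    |(⨆ k, a k) - ⨆ k, b k| ≤ c := by
  rw [abs_le]
  constructor
  · have : ⨆ k, b k ≤ (⨆ k, a k) + c := ciSup_le fun k => by
      linarith [le_ciSup_finite a k, (abs_le.1 (h k)).1]
    linarith
  · have : ⨆ k, a k ≤ (⨆ k, b k) + c := ciSup_le fun k => by
      linarith [le_ciSup_finite b k, (abs_le.1 (h k)).2]
    linarith

theorem integral_sum_pi_deviation_eq_zero {N : ℕ} (μ : Fin N → Measure X)
    [∀ t, IsProbabilityMeasure (μ t)] {ψ : Fin N → X → ℝ} (hψ : ∀ t, Integrable (ψ t) (μ t)) :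
    Integrable (fun x => ∑ t, (∫ y, ψ t y ∂(μ t) - ψ t (x t))) (Measure.pi μ) ∧
      ∫ x, ∑ t, (∫ y, ψ t y ∂(μ t) - ψ t (x t)) ∂(Measure.pi μ) = 0 := by
  have hi : ∀ t, Integrable (fun y : Fin N → X => ψ t (y t)) (Measure.pi μ) := fun t =>
    (measurePreserving_eval μ t).integrable_comp_of_integrable (hψ t)
  have hi' : ∀ t, Integrable (fun x : Fin N → X => ∫ y, ψ t y ∂(μ t) - ψ t (x t))
      (Measure.pi μ) := fun t => (integrable_const _).sub (hi t)
  refine ⟨integrable_finsetSum _ fun t _ => hi' t, ?_⟩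
  rw [integral_finsetSum _ fun t _ => hi' t]
  refine Finset.sum_eq_zero fun t _ => ?_
  rw [integral_sub (integrable_const _) (hi t)]
  have := (measurePreserving_eval μ t).map_eq
  have h2 : ∫ y : Fin N → X, ψ t (y t) ∂(Measure.pi μ) = ∫ y, ψ t y ∂(μ t) := by
    conv_rhs => rw [← this]
    rw [integral_map (measurable_pi_apply t).aemeasurable (by rw [this]; exact (hψ t).1)]
  rw [h2]
  simp

/-- Uniform deviations, relative to a reference function, of sums of independent bounded
variables with Rademacher averages at most `B`. -/
theorem measureReal_ciSup_deviation_ge_le {N : ℕ} (μ : Fin N → Measure X)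
    [∀ t, IsProbabilityMeasure (μ t)] {φ : Fin N → ι → X → ℝ} {ψ : Fin N → X → ℝ}
    (hφ : ∀ t k, Measurable (φ t k)) (hψ : ∀ t, Measurable (ψ t)) {M : ℝ}
    (hφM : ∀ t k x, φ t k x ∈ Set.Icc 0 M) (hψM : ∀ t x, ψ t x ∈ Set.Icc 0 M) {B : ℝ}
    (hB : ∀ x : Fin N → X, ∑ ε : Fin N → Bool,
      ⨆ k, ∑ t, (if ε t then φ t k (x t) else - φ t k (x t)) ≤ 2 ^ N * B) {s : ℝ} (hs : 0 ≤ s) :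
    (Measure.pi μ).real {x | 2 * B + s ≤ ⨆ k, (∑ t, (∫ y, φ t k y ∂(μ t) - φ t k (x t)) -
      ∑ t, (∫ y, ψ t y ∂(μ t) - ψ t (x t)))} ≤ Real.exp (-s ^ 2 / (2 * (N * M ^ 2))) := by
  have hφa : ∀ t k x, |φ t k x| ≤ M := fun t k x => by
    rw [abs_of_nonneg (hφM t k x).1]; exact (hφM t k x).2
  have hψa : ∀ t x, |ψ t x| ≤ M := fun t x => by
    rw [abs_of_nonneg (hψM t x).1]; exact (hψM t x).2
  set g : (Fin N → X) → ℝ := fun x => ∑ t, (∫ y, ψ t y ∂(μ t) - ψ t (x t)) with hg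
  set f₀ : (Fin N → X) → ℝ := fun x => ⨆ k, ∑ t, (∫ y, φ t k y ∂(μ t) - φ t k (x t)) with hf₀
  set f : (Fin N → X) → ℝ := fun x => ⨆ k, (∑ t, (∫ y, φ t k y ∂(μ t) - φ t k (x t)) - g x)
    with hf
  have hff : ∀ x, f x = f₀ x - g x := fun x =>
    (ciSup_sub (Set.finite_range _).bddAbove _).symm
  have hgm : Measurable g := Finset.measurable_sum _ fun t _ =>
    ((hψ t).comp (measurable_pi_apply t)).const_sub _
  have hfm : Measurable f := Measurable.iSup fun k => (Finset.measurable_sum _ fun t _ =>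
    ((hφ t k).comp (measurable_pi_apply t)).const_sub _).sub hgm
  have hupd : ∀ (η : Fin N → X → ℝ) (i : Fin N) (x : Fin N → X) (y : X) (e : Fin N → ℝ),
      ∑ t, (e t - η t (x t)) - ∑ t, (e t - η t (Function.update x i y t)) =
        η i y - η i (x i) := by
    intro η i x y e
    rw [← Finset.sum_sub_distrib, Finset.sum_eq_single i]
    · simp
    · intro t _ ht
      rw [Function.update_of_ne ht]
      simp
    · simp
  -- One coordinate moves the family and the reference by at most `M` each; the sub-Gaussian proxy
  -- is then `N * M ^ 2`.
  have hbd : ∀ i x y, |f x - f (Function.update x i y)| ≤ 2 * M := by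
    intro i x y
    refine abs_ciSup_sub_ciSup_le fun k => ?_
    have h1 := hupd (fun t => φ t k) i x y fun t => ∫ y, φ t k y ∂(μ t)
    have h2 := hupd ψ i x y fun t => ∫ y, ψ t y ∂(μ t)
    have h3 := hφM i k y
    have h4 := hφM i k (x i)
    have h5 := hψM i y
    have h6 := hψM i (x i)
    have h7 : ∑ t, (∫ y, φ t k y ∂(μ t) - φ t k (x t)) - g x -
        (∑ t, (∫ y, φ t k y ∂(μ t) - φ t k (Function.update x i y t)) -
          g (Function.update x i y)) =
        (φ i k y - φ i k (x i)) - (ψ i y - ψ i (x i)) := by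
      simp only [hg]
      linarith
    rw [h7, abs_le]
    constructor <;> linarith [h3.1, h3.2, h4.1, h4.2, h5.1, h5.2, h6.1, h6.2]
  have hfi : Integrable f (Measure.pi μ) := integrable_of_abs_sub_update_le hfm hbd
  have hsg := hasSubgaussianMGF_of_abs_sub_update_le μ hfm hbd
  obtain ⟨hgi, hg0⟩ := integral_sum_pi_deviation_eq_zero μ fun t =>
    Integrable.of_bound (hψ t).aestronglyMeasurable M (ae_of_all _ (hψa t))
  -- The reference term is centered, so it does not change the mean controlled by symmetrization.
  have hEf : ∫ x, f x ∂(Measure.pi μ) ≤ 2 * B := by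
    have h1 : ∫ x, f₀ x ∂(Measure.pi μ) = ∫ x, f x ∂(Measure.pi μ) := by
      have : f₀ = fun x => f x + g x := by ext x; rw [hff]; ring
      rw [this, integral_add hfi hgi, hg0, add_zero]
    rw [← h1]
    exact integral_ciSup_deviation_le μ hφ hφa hB
  refine le_trans (measureReal_mono fun x hx => ?_) ((hsg.measure_ge_le hs).trans (le_of_eq ?_))
  · simp only [Set.mem_ofPred_eq] at hx ⊢
    linarith
  · congr 2
    push_cast
    simp only [Real.norm_eq_abs, abs_mul, Finset.sum_const, Finset.card_univ, Fintype.card_fin,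
      nsmul_eq_mul]
    have : (|2| * |M| / 2) ^ 2 = M ^ 2 := by
      rw [← sq_abs M]; norm_num
    rw [this]

end FlatConcentration

/-! ### Cross-entropy loss -/

section CrossEntropy

variable {K : ℕ}

theorem continuous_crossEntropy (y : Fin K) :
    Continuous fun u : EuclideanSpace ℝ (Fin K) => crossEntropy u y := by
  unfold crossEntropy
  have hpos : ∀ u : EuclideanSpace ℝ (Fin K), 0 < ∑ i, Real.exp (u i) := fun u =>
    Finset.sum_pos (fun i _ => Real.exp_pos _) ⟨y, Finset.mem_univ y⟩
  refine (Continuous.log ?_ fun u => (div_pos (Real.exp_pos _) (hpos u)).ne').neg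
  exact Continuous.div (by fun_prop) (by fun_prop) fun u => (hpos u).ne'

theorem crossEntropy_nonneg (u : EuclideanSpace ℝ (Fin K)) (y : Fin K) : 0 ≤ crossEntropy u y := by
  unfold crossEntropy
  rw [neg_nonneg]
  refine Real.log_nonpos (by positivity) (div_le_one_of_le₀ ?_ (by positivity))
  exact Finset.single_le_sum (f := fun i => Real.exp (u i)) (fun i _ => (Real.exp_pos _).le)
    (Finset.mem_univ y)

theorem crossEntropy_eq_zero_of_subsingleton [Subsingleton (Fin K)]
    (u : EuclideanSpace ℝ (Fin K)) (y : Fin K) : crossEntropy u y = 0 := by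
  have : Finset.univ = {y} := by ext i; simp [Subsingleton.elim i y]
  unfold crossEntropy
  rw [this]
  simp

end CrossEntropy

/-! ### The data set as one product over `K * n` points -/

section Dataset

variable {X : Type*} [MeasurableSpace X] {K n : ℕ}

theorem datasetLaw_eq_map (P : Fin K → ProbabilityMeasure X) (n : ℕ) :
    datasetLaw P n = (Measure.pi fun t : Fin (K * n) =>
      (P (finProdFinEquiv.symm t).1 : Measure X)).map
        fun y i j => y (finProdFinEquiv (i, j)) := by
  have h1 := Measure.infinitePi_map_curry (ι := Fin K) (κ := Fin n) (X := X)
    (fun i _ => (P i : Measure X))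
  simp only [Measure.infinitePi_eq_pi] at h1
  unfold datasetLaw iidLaw
  rw [← h1]
  have h2 := Measure.pi_map_piCongrLeft (finProdFinEquiv (m := K) (n := n)).symm
    (β := fun _ => X) (fun p => (P p.1 : Measure X))
  rw [← h2, Measure.map_map (by fun_prop) (by fun_prop)]
  congr 1
  ext y i j
  simp [MeasurableEquiv.piCongrLeft, Equiv.piCongrLeft, MeasurableEquiv.curry]

/-- The average cross-entropy loss of the score function `u` on the data set `x`. -/
noncomputable def empLoss (u : X → EuclideanSpace ℝ (Fin K)) (x : Fin K → Fin n → X) : ℝ :=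
  1 / ((n : ℝ) * (K : ℝ)) * ∑ i, ∑ j, crossEntropy (u (x i j)) i

/-- The expected average loss of the score function `u`. -/
noncomputable def expLoss (n : ℕ) (u : X → EuclideanSpace ℝ (Fin K))
    (P : Fin K → ProbabilityMeasure X) : ℝ :=
  ∫ x, empLoss u x ∂(datasetLaw P n)

theorem measurable_empLoss {u : X → EuclideanSpace ℝ (Fin K)} (hu : Measurable u) :
    Measurable fun x : Fin K → Fin n → X => empLoss u x := by
  unfold empLoss
  refine (Finset.measurable_sum _ fun i _ => Finset.measurable_sum _ fun j _ => ?_).const_mul _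
  exact (continuous_crossEntropy i).measurable.comp (hu.comp (by fun_prop))

theorem empLoss_mem_Icc {X : Type*} {K n : ℕ} {u : X → EuclideanSpace ℝ (Fin K)} {M : ℝ} (hM0 : 0 ≤ M)
    (hM : ∀ i x, crossEntropy (u x) i ≤ M) (x : Fin K → Fin n → X) :
    empLoss u x ∈ Set.Icc 0 M := by
  unfold empLoss
  constructor
  · exact mul_nonneg (by positivity) (Finset.sum_nonneg fun i _ => Finset.sum_nonneg fun j _ =>
      crossEntropy_nonneg _ _)
  · have h1 : ∑ i, ∑ j, crossEntropy (u (x i j)) i ≤ ∑ _i : Fin K, ∑ _j : Fin n, M :=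
      Finset.sum_le_sum fun i _ => Finset.sum_le_sum fun j _ => hM i _
    simp only [Finset.sum_const, Finset.card_univ, Fintype.card_fin, nsmul_eq_mul] at h1
    rw [one_div_mul_eq_div]
    exact div_le_of_le_mul₀ (by positivity) hM0 (by linarith)

theorem expLoss_sub_empLoss {u : X → EuclideanSpace ℝ (Fin K)} (hu : Measurable u) {M : ℝ}
    (hM : ∀ i x, crossEntropy (u x) i ≤ M) (P : Fin K → ProbabilityMeasure X)
    (y : Fin (K * n) → X) :
    expLoss n u P - empLoss u (fun i j => y (finProdFinEquiv (i, j))) =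
      1 / ((n : ℝ) * (K : ℝ)) * ∑ t : Fin (K * n),
        (∫ z, crossEntropy (u z) (finProdFinEquiv.symm t).1 ∂(P (finProdFinEquiv.symm t).1) -
          crossEntropy (u (y t)) (finProdFinEquiv.symm t).1) := by
  have hmeas : Measurable fun (y : Fin (K * n) → X) (i : Fin K) (j : Fin n) =>
    y (finProdFinEquiv (i, j)) := by fun_prop
  have e : ∀ y : Fin (K * n) → X, empLoss u (fun i j => y (finProdFinEquiv (i, j))) =
      1 / ((n : ℝ) * (K : ℝ)) * ∑ t : Fin (K * n),
        crossEntropy (u (y t)) (finProdFinEquiv.symm t).1 := by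
    intro y
    unfold empLoss
    rw [← Fintype.sum_prod_type', ← finProdFinEquiv.sum_comp]
    simp
  have hci : ∀ i, Integrable (fun z => crossEntropy (u z) i) (P i : Measure X) := fun i =>
    .of_bound ((continuous_crossEntropy i).measurable.comp hu).aestronglyMeasurable M
      (ae_of_all _ fun z => by
        rw [Real.norm_of_nonneg (crossEntropy_nonneg _ _)]; exact hM i z)
  have h0 := integral_sum_pi_deviation_eq_zero
    (fun t : Fin (K * n) => (P (finProdFinEquiv.symm t).1 : Measure X))
    (ψ := fun t z => crossEntropy (u z) (finProdFinEquiv.symm t).1) fun t => hci _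
  obtain ⟨hi, h0⟩ := h0
  set E : ℝ := ∑ t : Fin (K * n), ∫ z, crossEntropy (u z) (finProdFinEquiv.symm t).1
    ∂(P (finProdFinEquiv.symm t).1) with hE
  simp only [Finset.sum_sub_distrib, ← hE] at hi h0 ⊢
  have hi2 : Integrable (fun y : Fin (K * n) → X => ∑ t,
      crossEntropy (u (y t)) (finProdFinEquiv.symm t).1)
      (Measure.pi fun t : Fin (K * n) => (P (finProdFinEquiv.symm t).1 : Measure X)) := by
    have := (integrable_const E).sub hi
    exact this.congr (ae_of_all _ fun y => by simp)
  rw [integral_sub (integrable_const _) hi2] at h0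
  have h1 : expLoss n u P = 1 / ((n : ℝ) * (K : ℝ)) * E := by
    unfold expLoss
    rw [datasetLaw_eq_map, integral_map hmeas.aemeasurable
      (measurable_empLoss hu).aestronglyMeasurable]
    simp_rw [e]
    rw [integral_const_mul]
    simp at h0
    congr 1
    simp
    linarith
  rw [h1, e]
  ring

end Dataset

/-! ### Deviation bounds for the pre-training loss -/

section PretrainDeviation

variable {X Z : Type*} [MeasurableSpace X] {K n : ℕ}

theorem lipschitzConst_nonneg (hK : 1 ≤ K) {L : ℝ}
    (hLip : ∀ (i : Fin K) (u v : EuclideanSpace ℝ (Fin K)),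
      |crossEntropy u i - crossEntropy v i| ≤ L * ‖u - v‖) : 0 ≤ L := by
  have h := (abs_nonneg _).trans (hLip ⟨0, hK⟩ (EuclideanSpace.single ⟨0, hK⟩ 1) 0)
  simpa using h

/-- For a family with one member the Gaussian average at one fixed point is `0`. -/
theorem complexityConst_nonneg [Nonempty X] {𝓕 : Set (Z → EuclideanSpace ℝ (Fin K))}
    {𝓗 : Set (X → Z)} {G : ℝ}
    (hG : ∀ (Q : ProbabilityMeasure X) (m : ℕ), 1 ≤ m →
      gaussianComplexity 𝓕 𝓗 Q m ≤ ((G * √(m : ℝ) : ℝ) : EReal))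
    {f : Z → EuclideanSpace ℝ (Fin K)} {h : X → Z} (hf : f ∈ 𝓕) (hh : h ∈ 𝓗)
    (hfh : Measurable fun x => f (h x)) : 0 ≤ G := by
  obtain ⟨x⟩ := ‹Nonempty X›
  have := gaussian_average_le (ι := Unit) hG (f := fun _ => f) (h := fun _ => h)
    (fun _ => hf) (fun _ => hh) (fun _ => hfh) (N := 1) le_rfl fun _ => x
  simp only [ciSup_const] at this
  rw [integral_gaussianMat_apply fun _ => f (h x)] at this
  simpa using this

/-- Rademacher averages of the loss over the data points `x t` with the labels `y t`. -/
theorem rademacher_crossEntropy_le {𝓕 : Set (Z → EuclideanSpace ℝ (Fin K))} {𝓗 : Set (X → Z)}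
    {G L : ℝ} (hK : 1 ≤ K)
    (hG : ∀ (Q : ProbabilityMeasure X) (m : ℕ), 1 ≤ m →
      gaussianComplexity 𝓕 𝓗 Q m ≤ ((G * √(m : ℝ) : ℝ) : EReal))
    (hLip : ∀ (i : Fin K) (u v : EuclideanSpace ℝ (Fin K)),
      |crossEntropy u i - crossEntropy v i| ≤ L * ‖u - v‖)
    {ι : Type*} [Finite ι] [Nonempty ι]
    {f : ι → Z → EuclideanSpace ℝ (Fin K)} {h : ι → X → Z}
    (hf : ∀ k, f k ∈ 𝓕) (hh : ∀ k, h k ∈ 𝓗) (hfh : ∀ k, Measurable fun x => f k (h k x))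
    {N : ℕ} (hN : 1 ≤ N) (x : Fin N → X) (y : Fin N → Fin K) :
    ∑ ε : Fin N → Bool, ⨆ k, ∑ t, (if ε t then crossEntropy (f k (h k (x t))) (y t)
      else - crossEntropy (f k (h k (x t))) (y t)) ≤ 2 ^ N * (L * √K * (G * √N)) := by
  have hL := lipschitzConst_nonneg hK hLip
  have hG0 : 0 ≤ G := by
    obtain ⟨k⟩ := ‹Nonempty ι›
    have : Nonempty X := ⟨x ⟨0, hN⟩⟩
    exact complexityConst_nonneg hG (hf k) (hh k) (hfh k)
  -- The constant `√(π / 2)` exceeds `1`, so replacing it by `√K` requires `K ≥ 2`.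
  rcases hK.eq_or_lt with rfl | hK2
  · simp only [crossEntropy_eq_zero_of_subsingleton, neg_zero, ite_self, Finset.sum_const_zero,
      ciSup_const]
    positivity
  · have h1 := rademacher_le_gaussian hL (fun _ : ι => 0)
      (fun t k => crossEntropy (f k (h k (x t))) (y t)) (fun t k => f k (h k (x t)))
      fun t k l => hLip (y t) _ _
    simp only [zero_add] at h1
    refine h1.trans (mul_le_mul_of_nonneg_left ?_ (by positivity))
    simp_rw [← Real.mul_iSup_of_nonneg (by positivity : 0 ≤ L * √(Real.pi / 2))]
    rw [integral_const_mul]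
    have h2 := gaussian_average_le hG hf hh hfh hN x
    have h3 : √(Real.pi / 2) ≤ √K := by
      refine Real.sqrt_le_sqrt ?_
      have : (2 : ℝ) ≤ K := by exact_mod_cast hK2
      linarith [Real.pi_le_four]
    exact (mul_le_mul_of_nonneg_left h2 (by positivity)).trans
      (mul_le_mul_of_nonneg_right (mul_le_mul_of_nonneg_left h3 hL) (by positivity))

/-- Uniform deviation of expected from average losses for a finite subclass. -/
theorem measureReal_ciSup_expLoss_sub_empLoss_ge_le (hK : 1 ≤ K) (hn : 1 ≤ n)
    {𝓕 : Set (Z → EuclideanSpace ℝ (Fin K))} {𝓗 : Set (X → Z)} {G L M : ℝ} (hM0 : 0 < M)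
    (hM : ∀ i, ∀ f ∈ 𝓕, ∀ h ∈ 𝓗, ∀ x, crossEntropy (f (h x)) i ≤ M)
    (hLip : ∀ (i : Fin K) (u v : EuclideanSpace ℝ (Fin K)),
      |crossEntropy u i - crossEntropy v i| ≤ L * ‖u - v‖)
    (hG : ∀ (Q : ProbabilityMeasure X) (m : ℕ), 1 ≤ m →
      gaussianComplexity 𝓕 𝓗 Q m ≤ ((G * √(m : ℝ) : ℝ) : EReal))
    {ι : Type*} [Finite ι] [Nonempty ι] {θ : ι → (Z → EuclideanSpace ℝ (Fin K)) × (X → Z)}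
    (hθ : ∀ k, θ k ∈ 𝓕 ×ˢ 𝓗) (hθm : ∀ k, Measurable fun x => (θ k).1 ((θ k).2 x)) (l : ι)
    (P : Fin K → ProbabilityMeasure X) {r : ℝ} (hr : 0 ≤ r) :
    (datasetLaw P n).real {x | 2 * M * √(r / (2 * n)) + 2 * G * L / √n ≤
      ⨆ k, ((expLoss n (fun z => (θ k).1 ((θ k).2 z)) P -
        empLoss (fun z => (θ k).1 ((θ k).2 z)) x) -
        (expLoss n (fun z => (θ l).1 ((θ l).2 z)) P -
        empLoss (fun z => (θ l).1 ((θ l).2 z)) x))} ≤ Real.exp (-r) := by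
  have hK0 : (0 : ℝ) < K := by positivity
  have hn0 : (0 : ℝ) < n := by positivity
  have hN : 1 ≤ K * n := Nat.mul_pos hK hn
  have hNc : ((K * n : ℕ) : ℝ) = K * n := by push_cast; ring
  have hN0 : (0 : ℝ) < n * K := by positivity
  -- With this `s` the tail exponent is `-(K * r)`, which is at most `-r`.
  set s : ℝ := n * K * (2 * M * √(r / (2 * n))) with hs
  have hMθ : ∀ k i x, crossEntropy ((θ k).1 ((θ k).2 x)) i ≤ M := fun k i x =>
    hM i _ (hθ k).1 _ (hθ k).2 x
  have hdm : Measurable fun (y : Fin (K * n) → X) (i : Fin K) (j : Fin n) =>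
    y (finProdFinEquiv (i, j)) := by fun_prop
  have hmeas : MeasurableSet {x : Fin K → Fin n → X | 2 * M * √(r / (2 * n)) + 2 * G * L / √n ≤
      ⨆ k, ((expLoss n (fun z => (θ k).1 ((θ k).2 z)) P -
        empLoss (fun z => (θ k).1 ((θ k).2 z)) x) -
        (expLoss n (fun z => (θ l).1 ((θ l).2 z)) P -
        empLoss (fun z => (θ l).1 ((θ l).2 z)) x))} :=
    measurableSet_le measurable_const (Measurable.iSup fun k =>
      ((measurable_empLoss (hθm k)).const_sub _).sub ((measurable_empLoss (hθm l)).const_sub _))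
  have hmain := measureReal_ciSup_deviation_ge_le
    (fun t : Fin (K * n) => (P (finProdFinEquiv.symm t).1 : Measure X))
    (φ := fun t k z => crossEntropy ((θ k).1 ((θ k).2 z)) (finProdFinEquiv.symm t).1)
    (ψ := fun t z => crossEntropy ((θ l).1 ((θ l).2 z)) (finProdFinEquiv.symm t).1)
    (fun t k => (continuous_crossEntropy _).measurable.comp (hθm k))
    (fun t => (continuous_crossEntropy _).measurable.comp (hθm l)) (M := M)
    (fun t k z => ⟨crossEntropy_nonneg _ _, hMθ k _ z⟩)
    (fun t z => ⟨crossEntropy_nonneg _ _, hMθ l _ z⟩)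
    (fun x => rademacher_crossEntropy_le hK hG hLip (fun k => (hθ k).1) (fun k => (hθ k).2)
      hθm hN x fun t => (finProdFinEquiv.symm t).1) (s := s) (by positivity)
  rw [datasetLaw_eq_map, map_measureReal_apply hdm hmeas]
  refine le_trans (measureReal_mono fun y hy => ?_) (hmain.trans ?_)
  · simp only [Set.mem_preimage, Set.mem_ofPred_eq] at hy ⊢
    simp_rw [expLoss_sub_empLoss (hθm _) (hMθ _), ← mul_sub] at hy
    rw [← Real.mul_iSup_of_nonneg (by positivity), one_div_mul_eq_div, le_div_iff₀ hN0] at hy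
    refine le_trans (le_of_eq ?_) hy
    rw [hNc, Real.sqrt_mul hK0.le, hs]
    have h1 : √(K : ℝ) * √K = K := Real.mul_self_sqrt hK0.le
    have h2 : 2 * G * L / √(n : ℝ) * (n * K) = 2 * G * L * √n * K := by
      have h3 : √(n : ℝ) * √n = n := Real.mul_self_sqrt hn0.le
      have h4 : √(n : ℝ) ≠ 0 := by positivity
      field_simp
      rw [sq, h3]
    rw [add_mul, h2]
    linear_combination (2 * L * G * √n) * h1
  · rw [Real.exp_le_exp, hs, hNc, mul_pow (n * K : ℝ), mul_pow (2 * M), Real.sq_sqrt (by positivity)]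
    have : -((n * K : ℝ) ^ 2 * ((2 * M) ^ 2 * (r / (2 * n)))) / (2 * (K * n * M ^ 2)) =
      -(K * r) := by
      field_simp
    rw [this]
    have : (1 : ℝ) ≤ K := by exact_mod_cast hK
    nlinarith

/-- With high probability, every approximate empirical risk minimizer in a countable class is an
approximate risk minimizer. -/
theorem measure_exists_approxERM_le (hK : 1 ≤ K) (hn : 1 ≤ n)
    {𝓕 : Set (Z → EuclideanSpace ℝ (Fin K))} {𝓗 : Set (X → Z)} {G L M : ℝ} (hM0 : 0 < M)
    (hM : ∀ i, ∀ f ∈ 𝓕, ∀ h ∈ 𝓗, ∀ x, crossEntropy (f (h x)) i ≤ M)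
    (hLip : ∀ (i : Fin K) (u v : EuclideanSpace ℝ (Fin K)),
      |crossEntropy u i - crossEntropy v i| ≤ L * ‖u - v‖)
    (hG : ∀ (Q : ProbabilityMeasure X) (m : ℕ), 1 ≤ m →
      gaussianComplexity 𝓕 𝓗 Q m ≤ ((G * √(m : ℝ) : ℝ) : EReal))
    {θ : ℕ → (Z → EuclideanSpace ℝ (Fin K)) × (X → Z)}
    (hθ : ∀ k, θ k ∈ 𝓕 ×ˢ 𝓗) (hθm : ∀ k, Measurable fun x => (θ k).1 ((θ k).2 x))
    (P : Fin K → ProbabilityMeasure X) {r ε t : ℝ} (hr : 0 ≤ r) (hε : 0 < ε)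
    (ht : 2 * M * √(r / (2 * n)) + 2 * G * L / √n + 2 * ε ≤ t) :
    datasetLaw P n {x | ∃ k, (∀ l, empLoss (fun z => (θ k).1 ((θ k).2 z)) x ≤
        empLoss (fun z => (θ l).1 ((θ l).2 z)) x + ε) ∧
      ∃ l, expLoss n (fun z => (θ l).1 ((θ l).2 z)) P + t <
        expLoss n (fun z => (θ k).1 ((θ k).2 z)) P} ≤ ENNReal.ofReal (Real.exp (-r)) := by
  set u : ℕ → X → EuclideanSpace ℝ (Fin K) := fun k z => (θ k).1 ((θ k).2 z) with hu
  have hbdd : BddBelow (Set.range fun l => expLoss n (u l) P) :=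
    ⟨0, by
      rintro _ ⟨l, rfl⟩
      exact integral_nonneg fun x => (empLoss_mem_Icc hM0.le
        (fun i x => hM i _ (hθ l).1 _ (hθ l).2 x) x).1⟩
  -- The reference is chosen from `P` alone, independently of the sample. One `ε` in `ht` pays for
  -- its suboptimality, the other for the approximate ERM.
  obtain ⟨l₀, hl₀⟩ := exists_lt_of_ciInf_lt
    (lt_add_of_pos_right (⨅ l, expLoss n (u l) P) hε)
  set D : ℕ → (Fin K → Fin n → X) → ℝ := fun k x =>
    (expLoss n (u k) P - empLoss (u k) x) - (expLoss n (u l₀) P - empLoss (u l₀) x) with hD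
  set a : ℝ := 2 * M * √(r / (2 * n)) + 2 * G * L / √n with ha
  set S : ℕ → Set (Fin K → Fin n → X) := fun m => {x | ∃ k ≤ m, a < D k x} with hS
  have hSmono : Monotone S := fun m m' hmm x ⟨k, hk, hx⟩ => ⟨k, hk.trans hmm, hx⟩
  have hbound : ∀ m, datasetLaw P n (S m) ≤ ENNReal.ofReal (Real.exp (-r)) := by
    intro m
    have h1 := measureReal_ciSup_expLoss_sub_empLoss_ge_le hK hn hM0 hM hLip hG
      -- The finite index set must contain the reference `l₀` as well as all `k ≤ m`.
      (ι := Fin (max m l₀ + 1)) (θ := fun k => θ k) (fun k => hθ k) (fun k => hθm k)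
      ⟨l₀, by omega⟩ P hr
    rw [← ENNReal.ofReal_le_ofReal_iff (Real.exp_nonneg _), ofReal_measureReal] at h1
    refine le_trans (measure_mono ?_) h1
    rintro x ⟨k, hk, hx⟩
    exact hx.le.trans (le_ciSup_finite (fun k : Fin (max m l₀ + 1) => D k x) ⟨k, by omega⟩)
  refine le_trans (measure_mono (t := ⋃ m, S m) ?_) ?_
  · rintro x ⟨k, hk, l, hl⟩
    refine Set.mem_iUnion.2 ⟨k, k, le_rfl, ?_⟩
    have h1 := hk l₀
    have h2 := ciInf_le hbdd l
    simp only [hD]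
    simp only [hu] at h1 h2 hl₀ ⊢
    linarith
  · rw [hSmono.measure_iUnion]
    exact iSup_le hbound

end PretrainDeviation

/-! ### From the dense sequence to all ERM feature extractors -/

section ERM

variable {X Z : Type*} [MeasurableSpace X] {K n : ℕ}

theorem PointwiseSeparable.exists_seq {X Z : Type*} {K : ℕ}
    {𝓕 : Set (Z → EuclideanSpace ℝ (Fin K))}
    {𝓗 : Set (X → Z)} (hsep : PointwiseSeparable 𝓕 𝓗) (h𝓕 : 𝓕.Nonempty) (h𝓗 : 𝓗.Nonempty) :
    ∃ θ : ℕ → (Z → EuclideanSpace ℝ (Fin K)) × (X → Z), (∀ k, θ k ∈ 𝓕 ×ˢ 𝓗) ∧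
      ∀ f ∈ 𝓕, ∀ h ∈ 𝓗, ∃ κ : ℕ → ℕ, ∀ x,
        Tendsto (fun i => (θ (κ i)).1 ((θ (κ i)).2 x)) atTop (𝓝 (f (h x))) := by
  obtain ⟨T, hT, hTs, hT'⟩ := hsep
  obtain ⟨f₀, hf₀⟩ := h𝓕
  obtain ⟨h₀, hh₀⟩ := h𝓗
  obtain ⟨u₀, hu₀, -⟩ := hT' f₀ hf₀ h₀ hh₀
  obtain ⟨θ, rfl⟩ := hT.exists_eq_range ⟨u₀ 0, hu₀ 0⟩
  refine ⟨θ, fun k => hTs ⟨k, rfl⟩, fun f hf h hh => ?_⟩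
  obtain ⟨u, hu, hlim⟩ := hT' f hf h hh
  choose κ hκ using hu
  exact ⟨κ, fun x => by simpa only [hκ] using hlim x⟩

theorem tendsto_empLoss {X : Type*} {K n : ℕ} {u : ℕ → X → EuclideanSpace ℝ (Fin K)}
    {v : X → EuclideanSpace ℝ (Fin K)} (h : ∀ x, Tendsto (fun i => u i x) atTop (𝓝 (v x)))
    (x : Fin K → Fin n → X) : Tendsto (fun i => empLoss (u i) x) atTop (𝓝 (empLoss v x)) := by
  unfold empLoss
  refine Tendsto.const_mul _ (tendsto_finsetSum _ fun i _ => tendsto_finsetSum _ fun j _ => ?_)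
  exact ((continuous_crossEntropy i).tendsto _).comp (h (x i j))

theorem tendsto_expLoss {u : ℕ → X → EuclideanSpace ℝ (Fin K)}
    {v : X → EuclideanSpace ℝ (Fin K)} (h : ∀ x, Tendsto (fun i => u i x) atTop (𝓝 (v x)))
    (hu : ∀ i, Measurable (u i)) {M : ℝ} (hM0 : 0 ≤ M)
    (hM : ∀ k i x, crossEntropy (u k x) i ≤ M) (P : Fin K → ProbabilityMeasure X) :
    Tendsto (fun i => expLoss n (u i) P) atTop (𝓝 (expLoss n v P)) := by
  unfold expLoss
  refine tendsto_integral_of_dominated_convergence (fun _ => M)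
    (fun k => (measurable_empLoss (hu k)).aestronglyMeasurable) (integrable_const _)
    (fun k => ae_of_all _ fun x => ?_) (ae_of_all _ fun x => tendsto_empLoss h x)
  rw [Real.norm_of_nonneg (empLoss_mem_Icc hM0 (hM k) x).1]
  exact (empLoss_mem_Icc hM0 (hM k) x).2

/-- If approximate empirical risk minimizers in a dense sequence of compositions have excess risk
at most `t`, then so have the feature extractors that minimize the empirical risk. -/
theorem pretrainError_le_of_isERM (hK : 1 ≤ K) (hn : 1 ≤ n)
    {𝓕 : Set (Z → EuclideanSpace ℝ (Fin K))} {𝓗 : Set (X → Z)}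
    (h𝓕 : 𝓕.Nonempty) (h𝓗 : 𝓗.Nonempty) {M : ℝ} (hM0 : 0 < M)
    (hM : ∀ i, ∀ f ∈ 𝓕, ∀ h ∈ 𝓗, ∀ x, crossEntropy (f (h x)) i ≤ M)
    {θ : ℕ → (Z → EuclideanSpace ℝ (Fin K)) × (X → Z)}
    (hθ : ∀ k, θ k ∈ 𝓕 ×ˢ 𝓗) (hθm : ∀ k, Measurable fun x => (θ k).1 ((θ k).2 x))
    (hdense : ∀ f ∈ 𝓕, ∀ h ∈ 𝓗, ∃ κ : ℕ → ℕ, ∀ x,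
      Tendsto (fun i => (θ (κ i)).1 ((θ (κ i)).2 x)) atTop (𝓝 (f (h x))))
    {P : Fin K → ProbabilityMeasure X} {x : Fin K → Fin n → X} {ε t : ℝ} (hε : 0 < ε)
    (hgood : ∀ k, (∀ l, empLoss (fun z => (θ k).1 ((θ k).2 z)) x ≤
        empLoss (fun z => (θ l).1 ((θ l).2 z)) x + ε) →
      ∀ l, expLoss n (fun z => (θ k).1 ((θ k).2 z)) P ≤
        expLoss n (fun z => (θ l).1 ((θ l).2 z)) P + t)
    {h : X → Z} (hERM : IsERM 𝓕 𝓗 x h) : pretrainError 𝓕 𝓗 n h P ≤ t := by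
  have : Nonempty 𝓕 := h𝓕.to_subtype
  have : Nonempty 𝓗 := h𝓗.to_subtype
  have hK0 : (0 : ℝ) < K := by positivity
  have hn0 : (0 : ℝ) < n := by positivity
  obtain ⟨hh, hmin⟩ := hERM
  have hMθ : ∀ k i x, crossEntropy ((θ k).1 ((θ k).2 x)) i ≤ M := fun k i x =>
    hM i _ (hθ k).1 _ (hθ k).2 x
  have hbelow : ∀ h' : X → Z, BddBelow (Set.range fun f : 𝓕 =>
      ∑ i, ∑ j, crossEntropy ((f : Z → _) (h' (x i j))) i) := fun h' => ⟨0, by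
    rintro _ ⟨f, rfl⟩
    exact Finset.sum_nonneg fun i _ => Finset.sum_nonneg fun j _ => crossEntropy_nonneg _ _⟩
  have hRbelow : ∀ h' ∈ 𝓗, BddBelow (Set.range fun f : 𝓕 =>
      expLoss n (fun z => (f : Z → _) (h' z)) P) := fun h' hh' => ⟨0, by
    rintro _ ⟨f, rfl⟩
    exact integral_nonneg fun x => (empLoss_mem_Icc hM0.le (fun i x => hM i _ f.2 _ hh' x) x).1⟩
  have hε' : 0 < ε * (n * K) := by positivity
  -- The infimum over classifiers need not be attained. The slack is strict, so members of the
  -- sequence close to `f ∘ h` are eventually `ε`-approximate minimizers.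
  obtain ⟨⟨f, hf⟩, hfe⟩ := exists_lt_of_ciInf_lt (lt_add_of_pos_right
    (⨅ f : 𝓕, ∑ i, ∑ j, crossEntropy ((f : Z → _) (h (x i j))) i) hε')
  have hlt : ∀ l, empLoss (fun z => (θ l).1 ((θ l).2 z)) x ≥ 1 / ((n : ℝ) * (K : ℝ)) *
      ⨅ f : 𝓕, ∑ i, ∑ j, crossEntropy ((f : Z → _) (h (x i j))) i := fun l => by
    unfold empLoss
    refine mul_le_mul_of_nonneg_left ?_ (by positivity)
    exact (hmin (hθ l).2).trans (ciInf_le (hbelow _) ⟨(θ l).1, (hθ l).1⟩)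
  have hfe' : empLoss (fun z => f (h z)) x < 1 / ((n : ℝ) * (K : ℝ)) *
      (⨅ f : 𝓕, ∑ i, ∑ j, crossEntropy ((f : Z → _) (h (x i j))) i) + ε := by
    unfold empLoss
    have := mul_lt_mul_of_pos_left hfe (by positivity : 0 < 1 / ((n : ℝ) * (K : ℝ)))
    refine this.trans_le (le_of_eq ?_)
    field_simp
  have hR : ∀ l, expLoss n (fun z => f (h z)) P ≤
      expLoss n (fun z => (θ l).1 ((θ l).2 z)) P + t := by
    intro l
    obtain ⟨κ, hκ⟩ := hdense f hf h hh
    refine le_of_tendsto (tendsto_expLoss hκ (fun i => hθm _) hM0.le (fun i => hMθ _) P) ?_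
    filter_upwards [(tendsto_empLoss hκ x).eventually_lt_const hfe'] with i hi
    refine hgood (κ i) (fun l => ?_) l
    linarith [hlt l]
  have hR' : ∀ f' ∈ 𝓕, ∀ h' ∈ 𝓗, expLoss n (fun z => f (h z)) P - t ≤
      expLoss n (fun z => f' (h' z)) P := by
    intro f' hf' h' hh'
    obtain ⟨κ, hκ⟩ := hdense f' hf' h' hh'
    refine ge_of_tendsto' (tendsto_expLoss hκ (fun i => hθm _) hM0.le (fun i => hMθ _) P)
      fun i => ?_
    linarith [hR (κ i)]
  have h1 : pretrainRisk 𝓕 n h P ≤ expLoss n (fun z => f (h z)) P :=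
    ciInf_le (hRbelow h hh) ⟨f, hf⟩
  have h2 : expLoss n (fun z => f (h z)) P - t ≤ ⨅ h' : 𝓗, pretrainRisk 𝓕 n (h' : X → Z) P :=
    le_ciInf fun h' => le_ciInf fun f' => hR' f' f'.2 h' h'.2
  unfold pretrainError
  linarith

theorem measurable_expLoss {u : X → EuclideanSpace ℝ (Fin K)} (hu : Measurable u) :
    Measurable fun P : Fin K → ProbabilityMeasure X => expLoss n u P :=
  ((measurable_empLoss hu).stronglyMeasurable.integral_kernel
    (κ := datasetKernel K n)).measurable

end ERM

/-! ### Concentration of the transfer coefficients -/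

section Transfer

variable {X : Type*} [MeasurableSpace X] {K : ℕ}

/-- Concentration of a function of the class distributions that is stable with constant `M / K`. -/
theorem classLaw_stable_ge_le (hK : 1 ≤ K) (D : Measure (ProbabilityMeasure X))
    [IsProbabilityMeasure D] {ν : (Fin K → ProbabilityMeasure X) → ℝ} (hν : Measurable ν) {M : ℝ}
    (hM : 0 < M) (hstable : ∀ P i Q, |ν P - ν (Function.update P i Q)| ≤ M / K) {r : ℝ}
    (hr : 0 ≤ r) {v : ℝ} (hv : ∫ P, ν P ∂(classLaw D K) + M * √(r / (2 * K)) ≤ v) :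
    classLaw D K {P | v < ν P} ≤ ENNReal.ofReal (Real.exp (-r)) := by
  have hK0 : (0 : ℝ) < K := by positivity
  have h1 := (hasSubgaussianMGF_of_abs_sub_update_le (fun _ : Fin K => D) hν
    fun i P Q => hstable P i Q).measure_ge_le
    (by positivity : 0 ≤ M * √(r / (2 * K)))
  -- The variance proxy is `K * (M / (2 * K)) ^ 2 = M ^ 2 / (4 * K)`.
  have h2 : -(M * √(r / (2 * K))) ^ 2 /
      (2 * ((∑ _i : Fin K, (‖M / K‖₊ / 2) ^ 2 : ℝ≥0) : ℝ)) = -r := by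
    push_cast
    simp only [Finset.sum_const, Finset.card_univ, Fintype.card_fin, nsmul_eq_mul]
    rw [Real.norm_of_nonneg (by positivity), mul_pow, Real.sq_sqrt (by positivity)]
    field_simp
  rw [h2, ← ENNReal.ofReal_le_ofReal_iff (Real.exp_nonneg _), ofReal_measureReal] at h1
  refine le_trans (measure_mono fun P hP => ?_) h1
  have hP' : v < ν P := hP
  change _ ≤ ν P - ∫ P, ν P ∂(classLaw D K)
  linarith

end Transfer

/-! ### Form and minimum of the bound -/

namespace BoundConstants

theorem bound_eq (c : BoundConstants) {n K : ℝ} (hn : 0 < n) (hK : 0 < K) :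
    c.bound n K = c.coeffA / √n + c.coeffB / √K + c.coeffC / √(n * K) + c.ν₀D := by
  have h : ∀ x : ℝ, 0 < x → √(Real.log (4 / c.δ) / (2 * x)) = √(Real.log (4 / c.δ) / 2) / √x :=
    fun x hx => by rw [← Real.sqrt_div' _ hx.le, div_div]
  unfold bound coeffA coeffB coeffC
  rw [h n hn, h K hK, Real.sqrt_mul hn.le]
  have h1 : √n ≠ 0 := by positivity
  have h2 : √K ≠ 0 := by positivity
  field_simp
  ring

/-- For fixed `n * K` only `A / √n + B / √K` varies. Its square is `(A / √n - B / √K) ^ 2` plus a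
constant, and the difference vanishes exactly at the stated ratio. -/
theorem bound_lt_bound (c : BoundConstants) (hA : 0 < c.coeffA) (hB : 0 < c.coeffB)
    {n₀ K₀ n₁ K₁ : ℝ} (hn₀ : 0 < n₀) (hK₀ : 0 < K₀) (hn₁ : 0 < n₁) (hK₁ : 0 < K₁)
    (hN : n₀ * K₀ = n₁ * K₁) (h₀ : K₀ / n₀ = c.coeffB ^ 2 / c.coeffA ^ 2)
    (h₁ : K₁ / n₁ ≠ c.coeffB ^ 2 / c.coeffA ^ 2) : c.bound n₀ K₀ < c.bound n₁ K₁ := by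
  rw [c.bound_eq hn₀ hK₀, c.bound_eq hn₁ hK₁, hN]
  set A := c.coeffA
  set B := c.coeffB
  have key : ∀ n K : ℝ, 0 < n → 0 < K →
      (A / √n + B / √K) ^ 2 = (A / √n - B / √K) ^ 2 + 4 * (A * B) / √(n * K) := by
    intro n K hn hK
    rw [Real.sqrt_mul hn.le]
    have h1 : √n ≠ 0 := by positivity
    have h2 : √K ≠ 0 := by positivity
    field_simp
    ring
  have hratio : ∀ n K : ℝ, 0 < n → 0 < K → (A / √n - B / √K = 0 ↔ K / n = B ^ 2 / A ^ 2) := by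
    intro n K hn hK
    have hs : (A / √n) ^ 2 = A ^ 2 / n := by rw [div_pow, Real.sq_sqrt hn.le]
    have hs' : (B / √K) ^ 2 = B ^ 2 / K := by rw [div_pow, Real.sq_sqrt hK.le]
    rw [sub_eq_zero, ← sq_eq_sq₀ (by positivity) (by positivity), hs, hs',
      div_eq_div_iff hn.ne' hK.ne', div_eq_div_iff hn.ne' (by positivity)]
    constructor <;> intro h <;> linarith
  have k₀ := key n₀ K₀ hn₀ hK₀
  have k₁ := key n₁ K₁ hn₁ hK₁
  rw [(hratio n₀ K₀ hn₀ hK₀).2 h₀, hN] at k₀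
  have h2 : 0 < (A / √n₁ - B / √K₁) ^ 2 := by
    have := fun h => h₁ ((hratio n₁ K₁ hn₁ hK₁).1 h)
    positivity
  have h3 : A / √n₀ + B / √K₀ < A / √n₁ + B / √K₁ :=
    lt_of_pow_lt_pow_left₀ 2 (by positivity) (by rw [k₀, k₁]; linarith)
  linarith

end BoundConstants

/-! ### Assembly -/

theorem theorem1 {d₁ d₂ K n K' N' : ℕ} (hK : 1 ≤ K) (hn : 1 ≤ n)
    -- feature extractors, pre-training classifiers and downstream classifiers
    (𝓗 : Set (EuclideanSpace ℝ (Fin d₁) → EuclideanSpace ℝ (Fin d₂)))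
    (𝓕 : Set (EuclideanSpace ℝ (Fin d₂) → EuclideanSpace ℝ (Fin K)))
    (𝓕' : Set (EuclideanSpace ℝ (Fin d₂) → EuclideanSpace ℝ (Fin K')))
    (h𝓗 : 𝓗.Nonempty) (h𝓕 : 𝓕.Nonempty) (h𝓕' : 𝓕'.Nonempty)
    (h𝓗_meas : ∀ h ∈ 𝓗, Measurable h) (h𝓕_meas : ∀ f ∈ 𝓕, Measurable f)
    (hsep : PointwiseSeparable 𝓕 𝓗)
    -- the meta-distribution
    (D : Measure (ProbabilityMeasure (EuclideanSpace ℝ (Fin d₁)))) [IsProbabilityMeasure D]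
    -- the downstream distribution; downstream risks are well defined
    (P' : Measure (EuclideanSpace ℝ (Fin d₁) × Fin K')) [IsProbabilityMeasure P']
    (hdown : ∀ f ∈ 𝓕', ∀ h ∈ 𝓗, Integrable (fun z => crossEntropy (f (h z.1)) z.2) P')
    -- the constants and the transfer coefficients
    (c : BoundConstants)
    (hδ : c.δ ∈ Set.Ioo (0 : ℝ) 1)
    (ν₀ ν₁ : (Fin K → ProbabilityMeasure (EuclideanSpace ℝ (Fin d₁))) → ℝ)
    (hν₀_meas : Measurable ν₀) (hν₁_meas : Measurable ν₁)
    -- bounded Lipschitz loss, and Gaussian complexity of order `√N`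
    (hMpos : 0 < c.Mloss)
    (hloss : ∀ i, ∀ f ∈ 𝓕, ∀ h ∈ 𝓗, ∀ x, crossEntropy (f (h x)) i ≤ c.Mloss)
    (hLip : ∀ (i : Fin K) (u v : EuclideanSpace ℝ (Fin K)),
      |crossEntropy u i - crossEntropy v i| ≤ c.Lloss * ‖u - v‖)
    (hG : ∀ (Q : ProbabilityMeasure (EuclideanSpace ℝ (Fin d₁))) (m : ℕ), 1 ≤ m →
      gaussianComplexity 𝓕 𝓗 Q m ≤ ((c.G * √(m : ℝ) : ℝ) : EReal))
    -- transfer from the pre-training error to the downstream error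
    (hν₀_nonneg : ∀ P, 0 ≤ ν₀ P) (hν₁_nonneg : ∀ P, 0 ≤ ν₁ P)
    (htransfer : ∀ P, ∀ h ∈ 𝓗,
      downstreamError 𝓕' 𝓗 P' N' h ≤ ν₁ P * pretrainError 𝓕 𝓗 n h P + ν₀ P)
    -- stability
    (hM₀pos : 0 < c.M₀) (hM₁pos : 0 < c.M₁)
    (hstable₀ : ∀ P i Q, |ν₀ P - ν₀ (Function.update P i Q)| ≤ c.M₀ / K)
    (hstable₁ : ∀ P i Q, |ν₁ P - ν₁ (Function.update P i Q)| ≤ c.M₁ / K)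
    -- concentration
    (hconc₀ : |(∫ P, ν₀ P ∂(classLaw D K)) - c.ν₀D| ≤ c.C₀ / √(K : ℝ))
    (hconc₁ : |(∫ P, ν₁ P ∂(classLaw D K)) - c.ν₁D| ≤ c.C₁ / √(K : ℝ)) :
    -- with probability at least `1 - δ`, the bound holds for the ERM feature extractor
    (∃ A : Set ((Fin K → ProbabilityMeasure (EuclideanSpace ℝ (Fin d₁))) ×
          (Fin K → Fin n → EuclideanSpace ℝ (Fin d₁))),
        MeasurableSet A ∧ ENNReal.ofReal (1 - c.δ) ≤ pretrainLaw D K n A ∧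
        ∀ S ∈ A, ∀ h, IsERM 𝓕 𝓗 S.2 h → downstreamError 𝓕' 𝓗 P' N' h ≤ c.bound n K) ∧
    -- the bound has the form `A / √n + B / √K + C / √N + ν₀(D)` with `N = n K`
    (∀ n₀ K₀ : ℝ, 0 < n₀ → 0 < K₀ →
      c.bound n₀ K₀ =
        c.coeffA / √n₀ + c.coeffB / √K₀ + c.coeffC / √(n₀ * K₀) + c.ν₀D) ∧
    -- for every fixed `N`, it is smallest exactly at the class-to-sample ratio `B² / A²`
    (0 < c.coeffA → ∀ N : ℝ, 0 < N → ∀ n₀ K₀ n₁ K₁ : ℝ, 0 < n₀ → 0 < K₀ → 0 < n₁ → 0 < K₁ →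
      n₀ * K₀ = N → n₁ * K₁ = N →
      K₀ / n₀ = c.coeffB ^ 2 / c.coeffA ^ 2 → K₁ / n₁ ≠ c.coeffB ^ 2 / c.coeffA ^ 2 →
      c.bound n₀ K₀ < c.bound n₁ K₁) := by
  have hK0 : (0 : ℝ) < K := by positivity
  have hn0 : (0 : ℝ) < n := by positivity
  obtain ⟨hδ0, hδ1⟩ := hδ
  set r : ℝ := Real.log (4 / c.δ) with hr
  have hr0 : 0 < r := Real.log_pos (by rw [lt_div_iff₀ hδ0]; linarith)
  have hexp : Real.exp (-r) = c.δ / 4 := by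
    rw [hr, Real.exp_neg, Real.exp_log (by positivity), inv_div]
  have hC₀ : 0 ≤ c.C₀ := by
    have := (abs_nonneg _).trans hconc₀
    by_contra! h
    exact absurd this (not_le.2 (div_neg_of_neg_of_pos h (by positivity)))
  refine ⟨?_, fun n₀ K₀ hn₀ hK₀ => c.bound_eq hn₀ hK₀,
    fun hA N _ n₀ K₀ n₁ K₁ hn₀ hK₀ hn₁ hK₁ h₀ h₁ => c.bound_lt_bound hA ?_ hn₀ hK₀ hn₁ hK₁
      (h₀.trans h₁.symm)⟩
  swap
  · unfold BoundConstants.coeffB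
    have : 0 < √(r / 2) := by positivity
    rw [← hr]
    positivity
  obtain ⟨θ, hθ, hdense⟩ := hsep.exists_seq h𝓕 h𝓗
  have hθm : ∀ k, Measurable fun x => (θ k).1 ((θ k).2 x) := fun k =>
    (h𝓕_meas _ (hθ k).1).comp (h𝓗_meas _ (hθ k).2)
  set t : ℝ := 5 * c.Mloss * √(r / (2 * n)) + 2 * c.G * c.Lloss / √n with ht
  -- The deviation bound costs `2 * ε` and the two approximations another `2 * ε`, within the `5 *
  -- ε` available in `t`.
  set ε : ℝ := c.Mloss * √(r / (2 * n)) with hε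
  have hε0 : 0 < ε := by
    have : 0 < √(r / (2 * n)) := by positivity
    positivity
  have ht0 : 0 ≤ t := by
    obtain ⟨f, hf⟩ := h𝓕
    obtain ⟨h, hh⟩ := h𝓗
    have h1 := complexityConst_nonneg hG hf hh ((h𝓕_meas f hf).comp (h𝓗_meas h hh))
    have h2 := lipschitzConst_nonneg hK hLip
    positivity
  set v₀ : ℝ := c.ν₀D + c.M₀ * √(r / (2 * K)) + c.C₀ / √K with hv₀
  set v₁ : ℝ := c.ν₁D + c.M₁ * √(r / (2 * K)) + c.C₁ / √K with hv₁
  have hbound : c.bound n K = v₁ * t + v₀ := by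
    rw [hv₀, hv₁, ht]
    unfold BoundConstants.bound
    rw [← hr]
    ring
  -- Stated through the countable sequence only, so that the bad event is measurable although the
  -- set of ERMs is arbitrary.
  set W : Set ((Fin K → ProbabilityMeasure (EuclideanSpace ℝ (Fin d₁))) ×
      (Fin K → Fin n → EuclideanSpace ℝ (Fin d₁))) :=
    {S | ∃ k, (∀ l, empLoss (fun z => (θ k).1 ((θ k).2 z)) S.2 ≤
        empLoss (fun z => (θ l).1 ((θ l).2 z)) S.2 + ε) ∧
      ∃ l, expLoss n (fun z => (θ l).1 ((θ l).2 z)) S.1 + t <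
        expLoss n (fun z => (θ k).1 ((θ k).2 z)) S.1} with hW
  have hWm : MeasurableSet W := by
    have he : ∀ k, Measurable fun S : (Fin K → ProbabilityMeasure (EuclideanSpace ℝ (Fin d₁))) ×
        (Fin K → Fin n → EuclideanSpace ℝ (Fin d₁)) =>
          empLoss (fun z => (θ k).1 ((θ k).2 z)) S.2 := fun k =>
      (measurable_empLoss (hθm k)).comp measurable_snd
    have hx : ∀ k, Measurable fun S : (Fin K → ProbabilityMeasure (EuclideanSpace ℝ (Fin d₁))) ×
        (Fin K → Fin n → EuclideanSpace ℝ (Fin d₁)) =>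
          expLoss n (fun z => (θ k).1 ((θ k).2 z)) S.1 := fun k =>
      (measurable_expLoss (hθm k)).comp measurable_fst
    simp only [hW, Set.ofPred_exists, Set.ofPred_and, Set.ofPred_forall]
    exact MeasurableSet.iUnion fun k => (MeasurableSet.iInter fun l =>
      measurableSet_le (he k) ((he l).add_const _)).inter
        (MeasurableSet.iUnion fun l => measurableSet_lt ((hx l).add_const _) (hx k))
  have hD₀ : MeasurableSet {P | v₀ < ν₀ P} := measurableSet_lt measurable_const hν₀_meas
  have hD₁ : MeasurableSet {P | v₁ < ν₁ P} := measurableSet_lt measurable_const hν₁_meas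
  have : IsProbabilityMeasure (classLaw D K) := by unfold classLaw; infer_instance
  have : IsMarkovKernel (datasetKernel (X := EuclideanSpace ℝ (Fin d₁)) K n) :=
    ⟨fun P => datasetLaw_isProbabilityMeasure P n⟩
  have : IsProbabilityMeasure (pretrainLaw D K n) := by unfold pretrainLaw; infer_instance
  have hfst : ∀ V : Set (Fin K → ProbabilityMeasure (EuclideanSpace ℝ (Fin d₁))),
      MeasurableSet V → pretrainLaw D K n (Prod.fst ⁻¹' V) = classLaw D K V := fun V hV => by
    unfold pretrainLaw
    rw [← Measure.fst_apply hV, Measure.fst_compProd]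
  have p₀ : pretrainLaw D K n (Prod.fst ⁻¹' {P | v₀ < ν₀ P}) ≤ ENNReal.ofReal (c.δ / 4) := by
    rw [hfst _ hD₀, ← hexp]
    refine classLaw_stable_ge_le hK D hν₀_meas hM₀pos hstable₀ hr0.le ?_
    linarith [(abs_le.1 hconc₀).2]
  have p₁ : pretrainLaw D K n (Prod.fst ⁻¹' {P | v₁ < ν₁ P}) ≤ ENNReal.ofReal (c.δ / 4) := by
    rw [hfst _ hD₁, ← hexp]
    refine classLaw_stable_ge_le hK D hν₁_meas hM₁pos hstable₁ hr0.le ?_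
    linarith [(abs_le.1 hconc₁).2]
  have p₂ : pretrainLaw D K n W ≤ ENNReal.ofReal (c.δ / 4) := by
    unfold pretrainLaw
    rw [Measure.compProd_apply hWm]
    refine (lintegral_mono fun P => ?_).trans (le_of_eq ((lintegral_const _).trans
      (by rw [measure_univ, mul_one])))
    rw [← hexp]
    refine measure_exists_approxERM_le hK hn hMpos hloss hLip hG hθ hθm P hr0.le hε0 ?_
    rw [ht, hε]
    have := hε0.le
    rw [hε] at this
    linarith
  set V := Prod.fst ⁻¹' {P | v₀ < ν₀ P} ∪ Prod.fst ⁻¹' {P | v₁ < ν₁ P} ∪ W with hV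
  have hVm : MeasurableSet V := ((measurable_fst hD₀).union (measurable_fst hD₁)).union hWm
  refine ⟨Vᶜ, hVm.compl, ?_, ?_⟩
  · rw [prob_compl_eq_one_sub hVm, ENNReal.ofReal_sub _ hδ0.le, ENNReal.ofReal_one]
    refine tsub_le_tsub_left ?_ _
    refine (measure_union_le _ _).trans ((add_le_add (measure_union_le _ _) le_rfl).trans
      ((add_le_add (add_le_add p₀ p₁) p₂).trans ?_))
    rw [← ENNReal.ofReal_add (by positivity) (by positivity),
      ← ENNReal.ofReal_add (by positivity) (by positivity)]
    -- Three events of probability at most `δ / 4` each leave `δ / 4` to spare.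
    exact ENNReal.ofReal_le_ofReal (by linarith)
  · rintro ⟨P, x⟩ hS h hERM
    simp only [hV, hW, Set.mem_compl_iff, Set.mem_union, Set.mem_preimage, Set.mem_ofPred_eq,
      not_or, not_exists, not_and, not_lt] at hS
    obtain ⟨⟨h₀, h₁⟩, h₂⟩ := hS
    have hE := pretrainError_le_of_isERM hK hn h𝓕 h𝓗 hMpos hloss hθ hθm hdense hε0 h₂ hERM
    rw [hbound]
    calc downstreamError 𝓕' 𝓗 P' N' h ≤ ν₁ P * pretrainError 𝓕 𝓗 n h P + ν₀ P :=
          htransfer P h hERM.1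
      _ ≤ ν₁ P * t + ν₀ P := by gcongr; exact hν₁_nonneg P
      _ ≤ v₁ * t + v₀ := by gcongr
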